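/- Let $\mathfrak g=\mathfrak{sl}_2(\mathbb C)$ with standard basis $f,h,e$, and let $\mathfrak T=\mathfrak g\otimes\mathbb C[x]/(x^2)$ be the Takiff $\mathfrak{sl}_2$, a complex Lie algebra with bracket $[v\otimes a,w\otimes b]=[v,w]\otimes ab$. Identify $\mathfrak g$ with $\mathfrak g\otimes 1$, and write $\bar v=v\otimes x$ and $\bar{\mathfrak g}=\mathfrak g\otimes x$. A $\mathfrak T$-module is called a $\mathfrak g$-Harish-Chandra module if its restriction to $\mathfrak g$ is a direct sum of simple finite-dimensional $\mathfrak g$-modules, each isomorphism class occurring with finite multiplicity. Put $\bar C=\bar h^2+4\bar f\bar e$, a central element of $U(\mathfrak T)$. Let $Q(0)=U(\mathfrak T)\otimes_{U(\mathfrak g)}\mathbb C$ be the module induced from the trivial $\mathfrak g$-module, and for $\chi\in\mathbb C$ let $Q(0,\chi)=Q(0)/(\bar C-\chi)Q(0)$. **Theorem.** (1) For every infinite-dimensional simple $\mathfrak g$-Harish-Chandra $\mathfrak T$-module $V$, $\operatorname{Ext}^1(V,V)\cong\mathbb C$ as complex vector spaces, where $\operatorname{Ext}^1$ is taken in the category of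 $U(\mathfrak T)$-modules. (2) Let $\chi\in\mathbb C\setminus\{0\}$. Regard $U(\bar{\mathfrak g})$ as a $\mathfrak T$-module on which $\mathfrak g$ acts by the adjoint action and $\bar{\mathfrak g}$ by left multiplication. Then there is a non-split short exact sequence of $\mathfrak T$-modules $$0\to Q(0,\chi)\to U(\bar{\mathfrak g})/(\bar C-\chi)^2\to Q(0,\chi)\to 0,$$ and for every non-split short exact sequence $0\to Q(0,\chi)\to M\to Q(0,\chi)\to 0$ of $\mathfrak T$-modules, $M\cong U(\bar{\mathfrak g})/(\bar C-\chi)^2$ as $\mathfrak T$-modules. -/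

import Mathlib

open scoped TensorProduct

noncomputable section

namespace TakiffSl2

/-! ### The Takiff Lie algebra of `𝔰𝔩₂` -/

/-- The Lie algebra `𝔤 = 𝔰𝔩₂(ℂ)` of traceless complex `2 × 2` matrices. -/
def Sl2 : Type := LieAlgebra.SpecialLinear.sl (Fin 2) ℂ

instance : LieRing Sl2 := inferInstanceAs (LieRing (LieAlgebra.SpecialLinear.sl (Fin 2) ℂ))

instance : LieAlgebra ℂ Sl2 :=
  inferInstanceAs (LieAlgebra ℂ (LieAlgebra.SpecialLinear.sl (Fin 2) ℂ))

/-- The Takiff Lie algebra `𝔗 = 𝔤 ⊗ ℂ[x]/(x²)`, a Lie algebra over `ℂ` with bracket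
`[v ⊗ a, w ⊗ b] = [v, w] ⊗ ab` (in the code the factor `ℂ[x]/(x²)` stands on the left). -/
def Takiff : Type := DualNumber ℂ ⊗[ℂ] Sl2

instance : LieRing Takiff := inferInstanceAs (LieRing (DualNumber ℂ ⊗[ℂ] Sl2))

instance : LieAlgebra ℂ Takiff := inferInstanceAs (LieAlgebra ℂ (DualNumber ℂ ⊗[ℂ] Sl2))

/-- The element `v ⊗ a` of `𝔗`. -/
def tens (a : DualNumber ℂ) : Sl2 →ₗ[ℂ] Takiff := TensorProduct.mk ℂ (DualNumber ℂ) Sl2 a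

lemma tens_lie (a b : DualNumber ℂ) (v w : Sl2) :
    ⁅tens a v, tens b w⁆ = tens (a * b) ⁅v, w⁆ := rfl

/-- The inclusion `𝔤 → 𝔗`, `v ↦ v ⊗ 1`. -/
def incl : Sl2 →ₗ⁅ℂ⁆ Takiff where
  toLinearMap := tens 1
  map_lie' := by
    intro v w
    change tens 1 ⁅v, w⁆ = ⁅tens 1 v, tens 1 w⁆
    rw [tens_lie, one_mul]

/-- The linear map `𝔤 → 𝔗`, `v ↦ v̄ = v ⊗ x`. -/
def bar : Sl2 →ₗ[ℂ] Takiff := tens DualNumber.eps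

/-- The component `v` of the element `v ⊗ 1 + w ⊗ x` of `𝔗`. -/
def even : Takiff →ₗ[ℂ] Sl2 :=
  TensorProduct.lift (LinearMap.lsmul ℂ Sl2 ∘ₗ (TrivSqZeroExt.fstHom ℂ ℂ ℂ).toLinearMap)

/-- The component `w` of the element `v ⊗ 1 + w ⊗ x` of `𝔗`. -/
def odd : Takiff →ₗ[ℂ] Sl2 :=
  TensorProduct.lift (LinearMap.lsmul ℂ Sl2 ∘ₗ TrivSqZeroExt.sndHom ℂ ℂ)

lemma even_tens (a : DualNumber ℂ) (v : Sl2) : even (tens a v) = a.fst • v := rfl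

lemma odd_tens (a : DualNumber ℂ) (v : Sl2) : odd (tens a v) = a.snd • v := rfl

lemma takiff_induction {P : Takiff → Prop} (zero : P 0) (tmul : ∀ a v, P (tens a v))
    (add : ∀ x y, P x → P y → P (x + y)) (t : Takiff) : P t :=
  TensorProduct.induction_on t zero tmul add

lemma even_lie (s t : Takiff) : even ⁅s, t⁆ = ⁅even s, even t⁆ := by
  induction s using takiff_induction with
  | zero => simp
  | add x y hx hy => simp [hx, hy]
  | tmul a v =>
    induction t using takiff_induction with
    | zero => simp
    | add x y hx hy => simp [hx, hy]
    | tmul b w =>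
      simp only [tens_lie, even_tens, TrivSqZeroExt.fst_mul, mul_smul, smul_lie, lie_smul]
      rw [smul_comm]

lemma odd_lie (s t : Takiff) : odd ⁅s, t⁆ = ⁅even s, odd t⁆ + ⁅odd s, even t⁆ := by
  induction s using takiff_induction with
  | zero => simp
  | add x y hx hy => simp only [add_lie, map_add, hx, hy]; abel
  | tmul a v =>
    induction t using takiff_induction with
    | zero => simp
    | add x y hx hy => simp only [lie_add, map_add, hx, hy]; abel
    | tmul b w =>
      simp only [tens_lie, even_tens, odd_tens, smul_lie, lie_smul, smul_smul, ← add_smul]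
      congr 1
      simp [mul_comm]

/-- The subalgebra `𝔤 = 𝔤 ⊗ 1` of `𝔗`. -/
def gSub : LieSubalgebra ℂ Takiff := incl.range

/-! ### Harish-Chandra modules and extensions -/

/-- A `𝔗`-module is a `𝔤`-Harish-Chandra module if its restriction to `𝔤` is the (internal) direct
sum of a family `𝒮` of simple finite-dimensional `𝔤`-submodules, in which each isomorphism class
occurs only finitely often. -/
def IsHarishChandra (V : Type*) [AddCommGroup V] [Module ℂ V] [LieRingModule Takiff V]
    [LieModule ℂ Takiff V] : Prop :=
  ∃ 𝒮 : Set (LieSubmodule ℂ gSub V),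
    sSupIndep 𝒮 ∧ sSup 𝒮 = ⊤ ∧
    (∀ S ∈ 𝒮, LieModule.IsIrreducible ℂ gSub S ∧ FiniteDimensional ℂ S) ∧
    ∀ S ∈ 𝒮, {S' ∈ 𝒮 | Nonempty (S ≃ₗ⁅ℂ, gSub⁆ S')}.Finite

/-- The universal enveloping algebra `U(𝔗)`. -/
abbrev U : Type := UniversalEnvelopingAlgebra ℂ Takiff

/-- A `𝔗`-module, regarded as an object of the category of all (left) `U(𝔗)`-modules. -/
def toModuleCat (V : Type*) [AddCommGroup V] [Module ℂ V] [LieRingModule Takiff V]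
    [LieModule ℂ Takiff V] : ModuleCat U :=
  letI : Module U V :=
    Module.compHom V (UniversalEnvelopingAlgebra.lift ℂ (LieModule.toEnd ℂ Takiff V)).toRingHom
  ModuleCat.of U V

section Sequences

variable {V M W : Type*}
  [AddCommGroup V] [Module ℂ V] [LieRingModule Takiff V] [LieModule ℂ Takiff V]
  [AddCommGroup M] [Module ℂ M] [LieRingModule Takiff M] [LieModule ℂ Takiff M]
  [AddCommGroup W] [Module ℂ W] [LieRingModule Takiff W] [LieModule ℂ Takiff W]

/-- `0 → V → M → W → 0` is a short exact sequence of `𝔗`-modules. -/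
def IsShortExact (i : V →ₗ⁅ℂ, Takiff⁆ M) (p : M →ₗ⁅ℂ, Takiff⁆ W) : Prop :=
  Function.Injective i ∧ Function.Exact i p ∧ Function.Surjective p

/-- The epimorphism `p` of `𝔗`-modules (or the short exact sequence which it ends) splits. -/
def IsSplit (p : M →ₗ⁅ℂ, Takiff⁆ W) : Prop :=
  ∃ s : W →ₗ⁅ℂ, Takiff⁆ M, ∀ w, p (s w) = w

end Sequences

/-! ### Elements of `U(𝔗)` -/

/-- The standard basis element `f` of `𝔰𝔩₂`. -/
def f : Sl2 := LieAlgebra.SpecialLinear.single (1 : Fin 2) 0 (by decide) (1 : ℂ)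

/-- The standard basis element `h` of `𝔰𝔩₂`. -/
def h : Sl2 := LieAlgebra.SpecialLinear.singleSubSingle (0 : Fin 2) 1 (1 : ℂ)

/-- The standard basis element `e` of `𝔰𝔩₂`. -/
def e : Sl2 := LieAlgebra.SpecialLinear.single (0 : Fin 2) 1 (by decide) (1 : ℂ)

/-- The image in `U(𝔗)` of an element `v` of `𝔤`. -/
def uIncl (v : Sl2) : U := UniversalEnvelopingAlgebra.ι ℂ (incl v)

/-- The image in `U(𝔗)` of `v̄`, for an element `v` of `𝔤`. -/
def uBar (v : Sl2) : U := UniversalEnvelopingAlgebra.ι ℂ (bar v)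

/-- `C̄ = h̄² + 4 f̄ ē`, the generator of the purely Takiff part of the center of `U(𝔗)`. -/
def Cbar : U := uBar h ^ 2 + 4 * (uBar f * uBar e)

/-- The algebra `U(𝔤̄)`, as the subalgebra of `U(𝔗)` generated by `𝔤̄ = 𝔤 ⊗ x`. -/
def UBar : Subalgebra ℂ U := Algebra.adjoin ℂ (Set.range uBar)

lemma uIncl_add (a b : Sl2) : uIncl (a + b) = uIncl a + uIncl b := by simp [uIncl]

lemma uIncl_smul (c : ℂ) (a : Sl2) : uIncl (c • a) = c • uIncl a := by simp [uIncl]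

lemma uBar_add (a b : Sl2) : uBar (a + b) = uBar a + uBar b := by simp [uBar]

lemma uBar_smul (c : ℂ) (a : Sl2) : uBar (c • a) = c • uBar a := by simp [uBar]

attribute [local instance 100] LieRing.ofAssociativeRing in
lemma iota_lie (s t : Takiff) : (UniversalEnvelopingAlgebra.ι ℂ ⁅s, t⁆ : U) =
    UniversalEnvelopingAlgebra.ι ℂ s * UniversalEnvelopingAlgebra.ι ℂ t -
      UniversalEnvelopingAlgebra.ι ℂ t * UniversalEnvelopingAlgebra.ι ℂ s := by
  rw [LieHom.map_lie, LieRing.of_associative_ring_bracket]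

lemma uIncl_lie (a b : Sl2) : uIncl ⁅a, b⁆ = uIncl a * uIncl b - uIncl b * uIncl a := by
  rw [uIncl, LieHom.map_lie, iota_lie]; rfl

lemma uBar_lie (a b : Sl2) : uBar ⁅a, b⁆ = uIncl a * uBar b - uBar b * uIncl a := by
  have : bar ⁅a, b⁆ = ⁅incl a, bar b⁆ := by
    change tens _ ⁅a, b⁆ = ⁅tens _ a, tens _ b⁆
    rw [tens_lie, one_mul]
  rw [uBar, this, iota_lie]; rfl

lemma uBar_lie' (a b : Sl2) : uBar ⁅a, b⁆ = uBar a * uIncl b - uIncl b * uBar a := by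
  rw [← lie_skew, ← neg_one_smul ℂ, uBar_smul, uBar_lie]; simp

lemma uBar_comm (a b : Sl2) : uBar a * uBar b = uBar b * uBar a := by
  have h1 : ⁅bar a, bar b⁆ = 0 := by
    change ⁅tens _ a, tens _ b⁆ = 0
    rw [tens_lie, DualNumber.eps_mul_eps]
    exact TensorProduct.zero_tmul _ _
  have h2 := iota_lie (bar a) (bar b)
  rw [h1, map_zero] at h2
  exact sub_eq_zero.mp h2.symm

lemma uBar_mem (b : Sl2) : uBar b ∈ UBar := Algebra.subset_adjoin ⟨b, rfl⟩

lemma Cbar_mem : Cbar ∈ UBar :=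
  add_mem (pow_mem (uBar_mem _) 2) (mul_mem (ofNat_mem UBar 4) (mul_mem (uBar_mem _) (uBar_mem _)))

lemma commutator_mem (a : Sl2) {u : U} (hu : u ∈ UBar) : uIncl a * u - u * uIncl a ∈ UBar := by
  induction hu using Algebra.adjoin_induction with
  | mem x hx =>
    obtain ⟨b, rfl⟩ := hx
    rw [← uBar_lie]; exact uBar_mem _
  | algebraMap r => rw [Algebra.commutes, sub_self]; exact zero_mem _
  | add x y _ _ hx hy =>
    have : uIncl a * (x + y) - (x + y) * uIncl a =
      (uIncl a * x - x * uIncl a) + (uIncl a * y - y * uIncl a) := by noncomm_ring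
    rw [this]; exact add_mem hx hy
  | mul x y hx' hy' hx hy =>
    have : uIncl a * (x * y) - (x * y) * uIncl a =
      (uIncl a * x - x * uIncl a) * y + x * (uIncl a * y - y * uIncl a) := by noncomm_ring
    rw [this]; exact add_mem (mul_mem hx hy') (mul_mem hx' hy)

lemma sl2_decomp (a : Sl2) : ∃ x y z : ℂ, a = x • f + y • h + z • e := by
  obtain ⟨m, hm⟩ := a
  refine ⟨m 1 0, m 0 0, m 0 1, Subtype.ext ?_⟩
  have ht : m 0 0 + m 1 1 = 0 := by
    have : m.trace = 0 := hm
    rwa [Matrix.trace_fin_two] at this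
  change m = m 1 0 • Matrix.single 1 0 1 + m 0 0 • (Matrix.single 0 0 1 - Matrix.single 1 1 1)
    + m 0 1 • Matrix.single 0 1 1
  ext i j
  fin_cases i <;> fin_cases j <;> simp [eq_neg_of_add_eq_zero_right ht]

lemma lie_h_e : ⁅h, e⁆ = (2 : ℂ) • e := by
  apply Subtype.ext
  change (Matrix.single 0 0 1 - Matrix.single 1 1 1) * Matrix.single 0 1 1 -
    Matrix.single 0 1 1 * (Matrix.single 0 0 1 - Matrix.single 1 1 1) =
    (2 : ℂ) • (Matrix.single 0 1 1 : Matrix (Fin 2) (Fin 2) ℂ)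
  ext i j
  fin_cases i <;> fin_cases j <;> simp [Matrix.mul_apply]; norm_num

lemma lie_h_f : ⁅h, f⁆ = (-2 : ℂ) • f := by
  apply Subtype.ext
  change (Matrix.single 0 0 1 - Matrix.single 1 1 1) * Matrix.single 1 0 1 -
    Matrix.single 1 0 1 * (Matrix.single 0 0 1 - Matrix.single 1 1 1) =
    (-2 : ℂ) • (Matrix.single 1 0 1 : Matrix (Fin 2) (Fin 2) ℂ)
  ext i j
  fin_cases i <;> fin_cases j <;> simp [Matrix.mul_apply]; norm_num

lemma lie_e_f : ⁅e, f⁆ = h := by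
  apply Subtype.ext
  change (Matrix.single 0 1 1 : Matrix (Fin 2) (Fin 2) ℂ) * Matrix.single 1 0 1 -
    Matrix.single 1 0 1 * Matrix.single 0 1 1 = Matrix.single 0 0 1 - Matrix.single 1 1 1
  ext i j
  fin_cases i <;> fin_cases j <;> simp

/-- `C̄` commutes with `𝔤`. -/
lemma Cbar_comm (a : Sl2) : uIncl a * Cbar = Cbar * uIncl a := by
  have hc : ∀ a : Sl2, uIncl a * Cbar = Cbar * uIncl a + (uBar h * uBar ⁅a, h⁆
      + uBar ⁅a, h⁆ * uBar h + 4 * (uBar f * uBar ⁅a, e⁆ + uBar ⁅a, f⁆ * uBar e)) := by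
    intro a; simp only [uBar_lie, Cbar]; noncomm_ring
  have z : uBar 0 = 0 := by simp [uBar]
  have hfh : ⁅f, h⁆ = (2 : ℂ) • f := by rw [← lie_skew, lie_h_f]; simp
  have heh : ⁅e, h⁆ = (-2 : ℂ) • e := by rw [← lie_skew, lie_h_e]; simp
  have hfe : ⁅f, e⁆ = (-1 : ℂ) • h := by rw [← lie_skew, lie_e_f]; simp
  have h4 : (4 : U) = algebraMap ℂ U 4 := (map_ofNat (algebraMap ℂ U) 4).symm
  have hf : uIncl f * Cbar = Cbar * uIncl f := by
    rw [hc, hfh, hfe, lie_self, z, uBar_smul, uBar_smul, h4, ← Algebra.smul_def,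
      mul_smul_comm, mul_smul_comm, smul_mul_assoc, uBar_comm h f]
    simp only [zero_mul]
    module
  have hh : uIncl h * Cbar = Cbar * uIncl h := by
    rw [hc, lie_self, z, lie_h_e, lie_h_f, uBar_smul, uBar_smul, h4, ← Algebra.smul_def,
      mul_smul_comm, smul_mul_assoc]
    simp only [mul_zero, zero_mul]
    module
  have he : uIncl e * Cbar = Cbar * uIncl e := by
    rw [hc, heh, lie_e_f, lie_self, z, uBar_smul, h4, ← Algebra.smul_def,
      mul_smul_comm, smul_mul_assoc, uBar_comm h e]
    simp only [mul_zero]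
    module
  obtain ⟨x, y, w, rfl⟩ := sl2_decomp a
  simp only [uIncl_add, uIncl_smul, add_mul, mul_add, smul_mul_assoc, mul_smul_comm, hf, hh, he]

lemma UBar_mul_comm {u v : U} (hu : u ∈ UBar) (hv : v ∈ UBar) : u * v = v * u := by
  refine Algebra.commute_of_mem_adjoin_of_forall_mem_commute hv fun b hb => ?_
  refine (Algebra.commute_of_mem_adjoin_of_forall_mem_commute hu fun b' hb' => ?_).symm
  obtain ⟨x, rfl⟩ := hb
  obtain ⟨y, rfl⟩ := hb'
  exact uBar_comm x y

/-! ### The `𝔗`-module `U(𝔤̄)` and its quotients -/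

/-- The `𝔗`-module structure on `U(𝔤̄)`: `𝔤` acts by the adjoint action `v ∘ u = v u - u v`, and
`𝔤̄` by left multiplication `w̄ ∘ u = w̄ u`. -/
instance : LieRingModule Takiff UBar where
  bracket t u := ⟨uIncl (even t) * u - u * uIncl (even t) + uBar (odd t) * u,
    add_mem (commutator_mem _ u.2) (mul_mem (uBar_mem _) u.2)⟩
  add_lie s t u := by
    ext; simp only [map_add, uIncl_add, uBar_add, AddMemClass.coe_add]; noncomm_ring
  lie_add s u v := by
    ext; simp only [AddMemClass.coe_add]; noncomm_ring
  leibniz_lie s t u := by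
    ext
    have h3 : uBar (odd s) * (uBar (odd t) * (u : U)) = uBar (odd t) * (uBar (odd s) * u) := by
      rw [← mul_assoc, uBar_comm, mul_assoc]
    simp only [even_lie, odd_lie, uIncl_lie, uBar_add, uBar_lie (even s), uBar_lie' (odd s),
      AddMemClass.coe_add]
    simp only [mul_add, add_mul, mul_sub, sub_mul, mul_assoc, h3]
    abel

lemma coe_lie (t : Takiff) (u : UBar) : ((⁅t, u⁆ : UBar) : U) =
    uIncl (even t) * u - u * uIncl (even t) + uBar (odd t) * u := rfl

instance : LieModule ℂ Takiff UBar where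
  smul_lie c t u := by
    ext; simp [coe_lie, uIncl_smul, uBar_smul, smul_sub]
  lie_smul c t u := by
    ext; simp [coe_lie, smul_sub]

/-- The ideal of the (commutative) algebra `U(𝔤̄)` generated by `(C̄ - χ)ᵏ`, that is
`{(C̄ - χ)ᵏ u | u ∈ U(𝔤̄)}`, as a `𝔗`-submodule. -/
def powIdeal (χ : ℂ) (k : ℕ) : LieSubmodule ℂ Takiff UBar where
  toSubmodule :=
    LinearMap.range (LinearMap.mulLeft ℂ ((⟨Cbar, Cbar_mem⟩ - algebraMap ℂ UBar χ) ^ k))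
  lie_mem := by
    rintro t _ ⟨u, rfl⟩
    refine ⟨⁅t, u⁆, ?_⟩
    have hx (a : Sl2) : Commute (uIncl a) ((Cbar - algebraMap ℂ U χ) ^ k) :=
      Commute.pow_right (Commute.sub_right (Cbar_comm a) (Algebra.commutes χ _).symm) k
    have hy (b : Sl2) : Commute (uBar b) ((Cbar - algebraMap ℂ U χ) ^ k) :=
      UBar_mul_comm (uBar_mem b) (pow_mem (sub_mem Cbar_mem (UBar.algebraMap_mem χ)) k)
    ext
    change (Cbar - algebraMap ℂ U χ) ^ k *
        (uIncl (even t) * u - u * uIncl (even t) + uBar (odd t) * u) =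
      uIncl (even t) * ((Cbar - algebraMap ℂ U χ) ^ k * u)
        - (Cbar - algebraMap ℂ U χ) ^ k * u * uIncl (even t)
        + uBar (odd t) * ((Cbar - algebraMap ℂ U χ) ^ k * u)
    rw [mul_add, mul_sub, ← mul_assoc (uIncl _), (hx _).eq, ← mul_assoc (uBar _), (hy _).eq]
    simp only [mul_assoc]

/-- The `𝔗`-module `U(𝔤̄) / (C̄ - χ)²`. -/
abbrev UBarModSq (χ : ℂ) : Type := UBar ⧸ powIdeal χ 2

/-! ### The universal module `Q(0, χ)` -/

/-- The induced module `Q(0) = U(𝔗) ⊗_{U(𝔤)} L(0)` of the trivial module, that is, the quotient of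
`U(𝔗)` by the left ideal generated by `𝔤`. -/
abbrev Q0 : Type := U ⧸ Submodule.span U (Set.range uIncl)

/-- The submodule `(C̄ - χ) Q(0)` of `Q(0)`. -/
def Q0Sub (χ : ℂ) : Submodule U Q0 :=
  Submodule.span U (Set.range fun w : Q0 => (Cbar - algebraMap ℂ U χ) • w)

/-- The universal module `Q(0, χ) = Q(0) / (C̄ - χ) Q(0)`. -/
def Qchi (χ : ℂ) : Type := Q0 ⧸ Q0Sub χ

instance (χ : ℂ) : AddCommGroup (Qchi χ) := inferInstanceAs (AddCommGroup (Q0 ⧸ Q0Sub χ))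

instance (χ : ℂ) : Module U (Qchi χ) := inferInstanceAs (Module U (Q0 ⧸ Q0Sub χ))

instance (χ : ℂ) : Module ℂ (Qchi χ) := Module.compHom _ (algebraMap ℂ U)

lemma smul_Qchi (χ c : ℂ) (w : Qchi χ) : c • w = algebraMap ℂ U c • w := rfl

instance (χ : ℂ) : LieRingModule Takiff (Qchi χ) where
  bracket t w := UniversalEnvelopingAlgebra.ι ℂ t • w
  add_lie s t w := by
    rw [map_add, add_smul]
  lie_add s u w := smul_add _ _ _
  leibniz_lie s t w := by
    change _ • (_ • w) = UniversalEnvelopingAlgebra.ι ℂ ⁅s, t⁆ • w + _ • (_ • w)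
    rw [iota_lie, sub_smul, mul_smul, mul_smul, sub_add_cancel]

lemma lie_Qchi (χ : ℂ) (t : Takiff) (w : Qchi χ) :
    ⁅t, w⁆ = (UniversalEnvelopingAlgebra.ι ℂ t : U) • w := rfl

instance (χ : ℂ) : LieModule ℂ Takiff (Qchi χ) where
  smul_lie c t w := by
    simp only [lie_Qchi, smul_Qchi, map_smul, Algebra.smul_def, mul_smul]
  lie_smul c t w := by
    simp only [lie_Qchi, smul_Qchi, ← mul_smul, Algebra.commutes]

end TakiffSl2

end

noncomputable section

namespace TakiffSl2

/-! Let V be an infinite-dimensional simple Harish-Chandra module. By Schur's lemma the central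
elements C̄ and `cMix` act by scalars χ and c. Let v be a highest weight vector of minimal weight n.
The component of 𝔤̄ v of highest weight n - 2 vanishes by minimality; this gives c² = n²χ and shows
that the vectors fʲ ēᵏ v span V. Infinite dimension makes all ēᵏ v nonzero, so those with j ≤ n + 2k
form a basis; simplicity then forces χ ≠ 0 (`exists_isGenerator`).

For (1), write V = U(𝔗)/Ann(v). Self-extensions are homomorphisms φ : Ann(v) → V modulo the maps a ↦
a x, and they are measured by φ(z), where z = C̄ - χ is central and kills V (`ext_self_equiv`). The
value φ(z) is a multiple of v. It is nonzero for the first-order rescaling of 𝔤̄, which multiplies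
C̄ by 1 + 2ε. If φ(z) = 0, then C̄ acts by χ on the generator of the extension. A Weyl-type argument
lifts v to a highest weight vector m (`exists_highest_lift`). The relation c² = n²χ, linearized,
leaves no freedom for `cMix` on m when n > 0, and `cMix` kills invariants when n = 0. So m satisfies
all relations of v, and the extension splits (`IsGenerator.smul_eq_zero_of_lift`).

For (2), U(𝔤̄) is a polynomial ring and Q(0, χ) is its quotient by C̄ - χ; multiplication by C̄ - χ
gives the sequence. In any extension M the generator of Q(0, χ) lifts to a 𝔤-invariant vector m, and
(C̄ - χ) m is a times the image of the generator. The sequence splits if a = 0; otherwise u ↦ u m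
induces the isomorphism. -/

lemma U_induction {P : U → Prop} (algebraMap : ∀ r : ℂ, P (algebraMap ℂ U r))
    (iota : ∀ t, P (UniversalEnvelopingAlgebra.ι ℂ t)) (mul : ∀ a b, P a → P b → P (a * b))
    (add : ∀ a b, P a → P b → P (a + b)) (u : U) : P u := by
  obtain ⟨u, rfl⟩ : ∃ x, UniversalEnvelopingAlgebra.mkAlgHom ℂ Takiff x = u :=
    (UniversalEnvelopingAlgebra.ringCon ℂ Takiff).mk'_surjective u
  induction u using TensorAlgebra.induction with
  | algebraMap r => rw [AlgHom.commutes]; exact algebraMap r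
  | ι t => exact iota t
  | mul a b ha hb => rw [map_mul]; exact mul _ _ ha hb
  | add a b ha hb => rw [map_add]; exact add _ _ ha hb

lemma takiff_decomp (t : Takiff) : t = incl (even t) + bar (odd t) := by
  induction t using takiff_induction with
  | zero => simp
  | add x y hx hy => simp only [map_add]; nth_rw 1 [hx, hy]; abel
  | tmul a v =>
    have ha : a = a.fst • 1 + a.snd • DualNumber.eps := by ext <;> simp
    rw [even_tens, odd_tens, map_smul, map_smul]
    conv_lhs => rw [ha]
    exact (TensorProduct.add_tmul _ _ _).trans (congrArg₂ (· + ·)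
      (TensorProduct.smul_tmul' _ _ _).symm (TensorProduct.smul_tmul' _ _ _).symm)

/-! ### Commutation relations and central elements -/

section Operators

variable {M : Type*} [AddCommGroup M] [Module ℂ M] [Module U M] [IsScalarTower ℂ U M]

/-- The action of an element of `U(𝔗)` on a module, as a `ℂ`-linear map. -/
def act (u : U) : M →ₗ[ℂ] M := Algebra.lsmul ℂ ℂ M u

/-- The action of `e`. -/
def eOp : M →ₗ[ℂ] M := act (uIncl e)
/-- The action of `f`. -/
def fOp : M →ₗ[ℂ] M := act (uIncl f)
/-- The action of `h`. -/
def hOp : M →ₗ[ℂ] M := act (uIncl h)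
/-- The action of `ē`. -/
def eBar : M →ₗ[ℂ] M := act (uBar e)
/-- The action of `f̄`. -/
def fBar : M →ₗ[ℂ] M := act (uBar f)
/-- The action of `h̄`. -/
def hBar : M →ₗ[ℂ] M := act (uBar h)

lemma eOp_def (m : M) : eOp m = uIncl e • m := rfl
lemma eBar_def (m : M) : eBar m = uBar e • m := rfl
lemma fBar_def (m : M) : fBar m = uBar f • m := rfl
lemma hBar_def (m : M) : hBar m = uBar h • m := rfl

lemma uIncl_swap {a b c : Sl2} {r : ℂ} (hab : ⁅a, b⁆ = r • c) (m : M) :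
    uIncl a • uIncl b • m = uIncl b • uIncl a • m + r • uIncl c • m := by
  have := uIncl_lie a b
  rw [hab, uIncl_smul] at this
  rw [← smul_assoc r, this, sub_smul, mul_smul, mul_smul]; abel

lemma uIncl_uBar_swap {a b c : Sl2} {r : ℂ} (hab : ⁅a, b⁆ = r • c) (m : M) :
    uIncl a • uBar b • m = uBar b • uIncl a • m + r • uBar c • m := by
  have := uBar_lie a b
  rw [hab, uBar_smul] at this
  rw [← smul_assoc r, this, sub_smul, mul_smul, mul_smul]; abel

lemma uIncl_uBar_comm (a : Sl2) (m : M) : uIncl a • uBar a • m = uBar a • uIncl a • m := by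
  have := uIncl_uBar_swap (a := a) (b := a) (c := 0) (r := 0) (by simp) m
  rwa [zero_smul, add_zero] at this

omit [Module ℂ M] [IsScalarTower ℂ U M] in
lemma uBar_swap (a b : Sl2) (m : M) : uBar a • uBar b • m = uBar b • uBar a • m := by
  rw [← mul_smul, uBar_comm, mul_smul]

lemma lie_f_e : ⁅f, e⁆ = (-1 : ℂ) • h := by rw [← lie_skew, lie_e_f]; simp
lemma lie_e_h : ⁅e, h⁆ = (-2 : ℂ) • e := by rw [← lie_skew, lie_h_e]; simp
lemma lie_f_h : ⁅f, h⁆ = (2 : ℂ) • f := by rw [← lie_skew, lie_h_f]; simp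

lemma e_f (m : M) : eOp (fOp m) = fOp (eOp m) + hOp m :=
  (uIncl_swap (lie_e_f.trans (one_smul ℂ h).symm) m).trans (by rw [one_smul]; rfl)
lemma h_f (m : M) : hOp (fOp m) = fOp (hOp m) - (2 : ℂ) • fOp m :=
  (uIncl_swap lie_h_f m).trans (by rw [neg_smul, ← sub_eq_add_neg]; rfl)
lemma h_e (m : M) : hOp (eOp m) = eOp (hOp m) + (2 : ℂ) • eOp m := uIncl_swap lie_h_e m
lemma e_fBar (m : M) : eOp (fBar m) = fBar (eOp m) + hBar m :=
  (uIncl_uBar_swap (lie_e_f.trans (one_smul ℂ h).symm) m).trans (by rw [one_smul]; rfl)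
lemma e_hBar (m : M) : eOp (hBar m) = hBar (eOp m) - (2 : ℂ) • eBar m :=
  (uIncl_uBar_swap lie_e_h m).trans (by rw [neg_smul, ← sub_eq_add_neg]; rfl)
lemma e_eBar (m : M) : eOp (eBar m) = eBar (eOp m) := uIncl_uBar_comm e m
lemma h_fBar (m : M) : hOp (fBar m) = fBar (hOp m) - (2 : ℂ) • fBar m :=
  (uIncl_uBar_swap lie_h_f m).trans (by rw [neg_smul, ← sub_eq_add_neg]; rfl)
lemma h_hBar (m : M) : hOp (hBar m) = hBar (hOp m) := uIncl_uBar_comm h m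
lemma h_eBar (m : M) : hOp (eBar m) = eBar (hOp m) + (2 : ℂ) • eBar m :=
  uIncl_uBar_swap lie_h_e m
lemma fBar_f (m : M) : fBar (fOp m) = fOp (fBar m) := (uIncl_uBar_comm f m).symm
lemma hBar_f (m : M) : hBar (fOp m) = fOp (hBar m) - (2 : ℂ) • fBar m :=
  eq_sub_of_add_eq (uIncl_uBar_swap lie_f_h m).symm
lemma eBar_f (m : M) : eBar (fOp m) = fOp (eBar m) + hBar m := by
  have := uIncl_uBar_swap lie_f_e m
  rw [neg_one_smul, ← sub_eq_add_neg] at this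
  exact (add_eq_of_eq_sub this).symm
lemma hBar_fBar (m : M) : hBar (fBar m) = fBar (hBar m) := uBar_swap _ _ _
lemma eBar_fBar (m : M) : eBar (fBar m) = fBar (eBar m) := uBar_swap _ _ _
lemma eBar_hBar (m : M) : eBar (hBar m) = hBar (eBar m) := uBar_swap _ _ _

/-- The action of `C̄`. -/
def cBar : M →ₗ[ℂ] M := act Cbar

lemma cBar_def (m : M) : cBar m = Cbar • m := rfl

lemma cBar_apply (m : M) : cBar m = hBar (hBar m) + (4 : ℂ) • fBar (eBar m) := by
  have h4 : (4 : U) = algebraMap ℂ U 4 := (map_ofNat (algebraMap ℂ U) 4).symm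
  simp only [cBar_def, Cbar, hBar_def, fBar_def, eBar_def, add_smul, pow_two, mul_smul, h4,
    algebraMap_smul]

/-- The action of the central element `h h̄ + 2 h̄ + 2 f ē + 2 f̄ e`. -/
def cMix : M →ₗ[ℂ] M :=
  hBar ∘ₗ hOp + (2 : ℂ) • hBar + (2 : ℂ) • fOp ∘ₗ eBar + (2 : ℂ) • fBar ∘ₗ eOp

lemma cMix_apply (m : M) : cMix m = hBar (hOp m) + (2 : ℂ) • hBar m + (2 : ℂ) • fOp (eBar m) +
    (2 : ℂ) • fBar (eOp m) := rfl

/-- The action of `(h + 1)² + 4 f e`. -/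
def casimir : M →ₗ[ℂ] M :=
  hOp ∘ₗ hOp + (2 : ℂ) • hOp + LinearMap.id + (4 : ℂ) • fOp ∘ₗ eOp

lemma casimir_apply (m : M) :
    casimir m = hOp (hOp m) + (2 : ℂ) • hOp m + m + (4 : ℂ) • fOp (eOp m) := rfl

lemma casimir_f (m : M) : casimir (fOp m) = fOp (casimir m) := by
  simp only [casimir_apply, e_f, h_f, map_add, map_sub, map_smul]; module

lemma cMix_f (m : M) : cMix (fOp m) = fOp (cMix m) := by
  simp only [cMix_apply, e_f, h_f, eBar_f, hBar_f, fBar_f, map_add, map_sub, map_smul]; module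

lemma cMix_e (m : M) : cMix (eOp m) = eOp (cMix m) := by
  simp only [cMix_apply, e_f, h_e, e_fBar, e_hBar, e_eBar, h_eBar, map_add, map_smul]; module

lemma cMix_eBar (m : M) : cMix (eBar m) = eBar (cMix m) := by
  simp only [cMix_apply, h_eBar, e_eBar, eBar_hBar, eBar_f, eBar_fBar,
    map_add, map_smul]; module

lemma cBar_f (m : M) : cBar (fOp m) = fOp (cBar m) := by
  simp only [cBar_apply, eBar_f, hBar_f, fBar_f, hBar_fBar, map_add, map_sub, map_smul]; module

lemma cBar_e (m : M) : cBar (eOp m) = eOp (cBar m) := by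
  simp only [cBar_apply, e_fBar, e_hBar, e_eBar, eBar_hBar, map_add, map_sub, map_smul]; module

lemma cBar_eBar (m : M) : cBar (eBar m) = eBar (cBar m) := by
  simp only [cBar_apply, eBar_fBar, eBar_hBar, map_add, map_smul]

/-- `e`, `f` and `ē` generate the action of `U(𝔗)`. -/
lemma smul_mem_of_generators (S : Submodule ℂ M) (he : ∀ m ∈ S, eOp m ∈ S)
    (hf : ∀ m ∈ S, fOp m ∈ S) (hb : ∀ m ∈ S, eBar m ∈ S) (u : U) {m : M} (hm : m ∈ S) :
    u • m ∈ S := by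
  -- h = [e, f], h̄ = [ē, f], and 2 f̄ = [f, h̄].
  have h1 : ∀ m ∈ S, hOp m ∈ S := fun m hm => by
    rw [eq_sub_of_add_eq' (e_f m).symm]; exact sub_mem (he _ (hf _ hm)) (hf _ (he _ hm))
  have h2 : ∀ m ∈ S, hBar m ∈ S := fun m hm => by
    rw [eq_sub_of_add_eq' (eBar_f m).symm]; exact sub_mem (hb _ (hf _ hm)) (hf _ (hb _ hm))
  have h3 : ∀ m ∈ S, fBar m ∈ S := fun m hm => by
    have := hBar_f m
    have : fBar m = (2⁻¹ : ℂ) • (fOp (hBar m) - hBar (fOp m)) := by rw [this]; module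
    rw [this]; exact S.smul_mem _ (sub_mem (hf _ (h2 _ hm)) (h2 _ (hf _ hm)))
  have key : ∀ t : Takiff, ∀ m ∈ S, (UniversalEnvelopingAlgebra.ι ℂ t : U) • m ∈ S := by
    have hincl : ∀ v : Sl2, ∀ m ∈ S, uIncl v • m ∈ S := fun v m hm => by
      obtain ⟨x, y, z, rfl⟩ := sl2_decomp v
      simp only [uIncl_add, uIncl_smul, add_smul, smul_assoc]
      exact add_mem (add_mem (S.smul_mem _ (hf m hm)) (S.smul_mem _ (h1 m hm)))
        (S.smul_mem _ (he m hm))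
    have hbar : ∀ v : Sl2, ∀ m ∈ S, uBar v • m ∈ S := fun v m hm => by
      obtain ⟨x, y, z, rfl⟩ := sl2_decomp v
      simp only [uBar_add, uBar_smul, add_smul, smul_assoc]
      exact add_mem (add_mem (S.smul_mem _ (h3 m hm)) (S.smul_mem _ (h2 m hm)))
        (S.smul_mem _ (hb m hm))
    intro t m hm
    rw [takiff_decomp t, map_add, add_smul]
    exact add_mem (hincl _ m hm) (hbar _ m hm)
  induction u using U_induction generalizing m with
  | algebraMap r => rw [algebraMap_smul]; exact S.smul_mem _ hm
  | iota t => exact key t m hm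
  | mul a b ha hb => rw [mul_smul]; exact ha (hb hm)
  | add a b ha hb => rw [add_smul]; exact add_mem (ha hm) (hb hm)

end Operators

/-! ### Highest weight vectors and the strings they generate -/

section Highest

variable {M : Type*} [AddCommGroup M] [Module ℂ M] [Module U M] [IsScalarTower ℂ U M]

/-- `w` is zero or a highest weight vector of weight `N` for the action of `𝔤`. -/
structure IsHighest (w : M) (N : ℂ) : Prop where
  e : eOp w = 0
  h : hOp w = N • w

namespace IsHighest

variable {w : M} {N : ℂ}

lemma h_pow (hw : IsHighest w N) (j : ℕ) : hOp ((fOp ^ j) w) = (N - 2 * j) • (fOp ^ j) w := by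
  induction j with
  | zero => simpa using hw.h
  | succ j ih =>
    rw [pow_succ', Module.End.mul_apply, h_f, ih, map_smul]
    push_cast; module

lemma e_pow (hw : IsHighest w N) (j : ℕ) :
    eOp ((fOp ^ (j + 1)) w) = ((j + 1) * (N - j)) • (fOp ^ j) w := by
  induction j with
  | zero => simp [e_f, hw.e, hw.h]
  | succ j ih =>
    rw [pow_succ', Module.End.mul_apply, e_f, ih, map_smul, ← Module.End.mul_apply fOp,
      ← pow_succ', hw.h_pow]
    push_cast; module

lemma eBar (hw : IsHighest w N) : IsHighest (eBar w) (N + 2) :=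
  ⟨by rw [e_eBar, hw.e, map_zero], by rw [h_eBar, hw.h, map_smul]; module⟩

lemma eBar_pow (hw : IsHighest w N) (k : ℕ) :
    IsHighest ((TakiffSl2.eBar ^ k) w) (N + 2 * k) := by
  induction k with
  | zero => simpa using hw
  | succ k ih =>
    rw [pow_succ', Module.End.mul_apply]
    convert ih.eBar using 1; push_cast; ring

lemma cMix (hw : IsHighest w N) : IsHighest (cMix w) N :=
  ⟨by rw [← cMix_e, hw.e, map_zero], by
    have h1 : hOp (TakiffSl2.cMix w) =
        eOp (fOp (TakiffSl2.cMix w)) - fOp (eOp (TakiffSl2.cMix w)) := by rw [e_f]; abel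
    rw [h1, ← cMix_f, ← cMix_e, ← cMix_e, ← cMix_f, ← map_sub, e_f, add_sub_cancel_left, hw.h,
      map_smul]⟩

lemma casimir_pow (hw : IsHighest w N) (j : ℕ) :
    casimir ((fOp ^ j) w) = (N + 1) ^ 2 • (fOp ^ j) w := by
  induction j with
  | zero =>
    simp only [pow_zero, Module.End.one_apply, casimir_apply, hw.e, hw.h, map_smul, map_zero]
    module
  | succ j ih => rw [pow_succ', Module.End.mul_apply, casimir_f, ih, map_smul]

/-- On a highest weight vector the terms of `cMix` containing e drop out and h becomes N. For N ≠ -2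
this expresses h̄ w through `cMix`, f and ē. -/
lemma hBar (hw : IsHighest w N) :
    (N + 2) • hBar w = TakiffSl2.cMix w - (2 : ℂ) • fOp (TakiffSl2.eBar w) := by
  rw [cMix_apply, hw.e, hw.h, map_zero, map_smul]; module

/-- Apply h̄ to the preceding identity and eliminate h̄² w by the formula for C̄; moving h̄ past f
contributes the extra multiple of f̄ ē w. The coefficient is nonzero for every natural N. -/
lemma fBar_eBar (hw : IsHighest w N) :
    (4 * N + 12) • fBar (TakiffSl2.eBar w) =
      (N + 2) • cBar w - TakiffSl2.hBar (TakiffSl2.cMix w)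
        + (2 : ℂ) • fOp (TakiffSl2.hBar (TakiffSl2.eBar w)) := by
  have h1 := congrArg TakiffSl2.hBar hw.hBar
  simp only [map_sub, map_smul, hBar_f] at h1
  have h2 := cBar_apply w
  linear_combination (norm := module) -h1 - (N + 2) • h2

end IsHighest

/-- The lowering operator on highest weight vectors of weight `n`. -/
def lower (n : ℂ) (m : M) : M :=
  (n * (n + 1)) • fBar m - (n + 1) • fOp (hBar m) - fOp (fOp (eBar m))

/-- Among the vectors f̄ m, f h̄ m and f² ē m of weight n - 2, this is the combination killed by e:
the summand of highest weight n - 2 in 𝔤̄ ⊗ L(n). -/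
lemma IsHighest.lower {m : M} {n : ℂ} (hm : IsHighest m n) : IsHighest (lower n m) (n - 2) := by
  constructor
  · simp only [TakiffSl2.lower, map_sub, map_smul, e_fBar, e_f, e_hBar, e_eBar, h_hBar, h_f,
      h_eBar, hm.e, hm.h, map_zero, map_add]
    module
  · simp only [TakiffSl2.lower, map_sub, map_smul, h_fBar, h_hBar, h_f,
      h_eBar, hm.h, map_add]
    module

/-- Applying ē to `lower n m = 0` returns to weight n. The formulas for h̄ and f̄ ē on highest
weight vectors then eliminate everything except the two central operators. -/
lemma cMix_cMix {m : M} {n : ℂ} (hn : n + 2 ≠ 0) (hm : IsHighest m n) (hl : lower n m = 0) :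
    cMix (cMix m) = n ^ 2 • cBar m := by
  have a2 := congrArg fOp hm.eBar.hBar
  have a3 := hm.cMix.hBar
  have b1 := hm.fBar_eBar
  have b2 := congrArg eBar hl
  have b3 := cBar_apply m
  rw [cMix_eBar] at a2
  simp only [lower, map_sub, map_smul, map_add, map_zero, eBar_fBar, eBar_f, eBar_hBar,
    hBar_f] at a2 b2
  have : (n + 2) • (cMix (cMix m) - n ^ 2 • cBar m) = 0 := by
    linear_combination (norm := module) (4 * (n + 1) * (n + 2)) • b3 - (4 * (n + 2)) • b2
      - (2 * (n + 2)) • a2 + ((n + 2) * (n + 2)) • b1 - (n + 2) • a3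
  exact sub_eq_zero.mp ((smul_eq_zero.mp this).resolve_left hn)

lemma hBar_of_invariant {m : M} (hf : fOp m = 0) : hBar m = - fOp (eBar m) := by
  have := eBar_f m
  rw [hf, map_zero] at this
  exact (neg_eq_of_add_eq_zero_right this.symm).symm

lemma fBar_of_invariant {m : M} (hf : fOp m = 0) : (2 : ℂ) • fBar m = fOp (hBar m) := by
  have := hBar_f m
  rw [hf, map_zero] at this
  exact (sub_eq_zero.mp this.symm).symm

lemma cMix_of_invariant {m : M} (hm : IsHighest m 0) (hf : fOp m = 0) : cMix m = 0 := by
  rw [cMix_apply, hm.e, hm.h, hBar_of_invariant hf]; simp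

/-- The span of the vectors `fʲ ēᵏ m`. -/
def strings (m : M) : Submodule ℂ M :=
  Submodule.span ℂ (Set.range fun p : ℕ × ℕ => (fOp ^ p.1) ((eBar ^ p.2) m))

lemma mem_strings (m : M) (j k : ℕ) : (fOp ^ j) ((eBar ^ k) m) ∈ strings m :=
  Submodule.subset_span ⟨(j, k), rfl⟩

lemma eBar_pow_mem_strings (m : M) (k : ℕ) : (eBar ^ k) m ∈ strings m := mem_strings m 0 k

lemma self_mem_strings (m : M) : m ∈ strings m := mem_strings m 0 0

lemma fOp_mem_strings {m x : M} (hx : x ∈ strings m) : fOp x ∈ strings m := by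
  induction hx using Submodule.span_induction with
  | zero => simp
  | add x y _ _ hx hy => rw [map_add]; exact add_mem hx hy
  | smul r x _ hx => rw [map_smul]; exact Submodule.smul_mem _ _ hx
  | mem x hx =>
    obtain ⟨⟨j, k⟩, rfl⟩ := hx
    have := mem_strings m (j + 1) k
    rwa [pow_succ', Module.End.mul_apply] at this

/-- The three memberships must be carried together: moving ē past f produces h̄, and moving h̄ past
f produces f̄. -/
lemma bar_pow_mem {S : Submodule ℂ M} (hS : ∀ x ∈ S, fOp x ∈ S) {w : M} (he : eBar w ∈ S)
    (hh : hBar w ∈ S) (hf : fBar w ∈ S) (j : ℕ) :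
    eBar ((fOp ^ j) w) ∈ S ∧ hBar ((fOp ^ j) w) ∈ S ∧ fBar ((fOp ^ j) w) ∈ S := by
  induction j with
  | zero => exact ⟨he, hh, hf⟩
  | succ j ih =>
    obtain ⟨h1, h2, h3⟩ := ih
    rw [pow_succ', Module.End.mul_apply, eBar_f, hBar_f, fBar_f]
    exact ⟨add_mem (hS _ h1) h2, sub_mem (hS _ h2) (S.smul_mem _ h3), hS _ h3⟩

lemma cMix_eBar_pow {m : M} {c : ℂ} (hc : cMix m = c • m) (k : ℕ) :
    cMix ((eBar ^ k) m) = c • (eBar ^ k) m := by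
  induction k with
  | zero => exact hc
  | succ k ih => rw [pow_succ', Module.End.mul_apply, cMix_eBar, ih, map_smul]

lemma cBar_eBar_pow {m : M} {c : ℂ} (hc : cBar m = c • m) (k : ℕ) :
    cBar ((eBar ^ k) m) = c • (eBar ^ k) m := by
  induction k with
  | zero => exact hc
  | succ k ih => rw [pow_succ', Module.End.mul_apply, cBar_eBar, ih, map_smul]

lemma nat_add_ne_zero (n k : ℕ) (h : 0 < k) : (n : ℂ) + k ≠ 0 := by
  exact_mod_cast (by omega : n + k ≠ 0)

/-- All ēᵏ m are highest weight vectors with the same central scalars, so `IsHighest.hBar` controls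
h̄ on them, and `IsHighest.fBar_eBar` controls f̄ for k ≥ 1. Only f̄ m has to be assumed. -/
theorem smul_mem_strings {m : M} {n : ℕ} {c χ : ℂ} (hm : IsHighest m n) (hc : cMix m = c • m)
    (hχ : cBar m = χ • m) (hf : fBar m ∈ strings m) (u : U) {x : M} (hx : x ∈ strings m) :
    u • x ∈ strings m := by
  set S := strings m with hS
  have sf : ∀ x ∈ S, fOp x ∈ S := fun x hx => fOp_mem_strings hx
  have hN (k : ℕ) : (n + 2 * k : ℂ) = ((n + 2 * k : ℕ) : ℂ) := by push_cast; rfl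
  have sh (k : ℕ) : hBar ((eBar ^ k) m) ∈ S := by
    have h1 := (hm.eBar_pow k).hBar
    rw [hN] at h1
    refine (S.smul_mem_iff (nat_add_ne_zero (n + 2 * k) 2 two_pos)).mp ?_
    push_cast at h1 ⊢
    rw [h1, cMix_eBar_pow hc, ← Module.End.mul_apply TakiffSl2.eBar, ← pow_succ']
    exact sub_mem (S.smul_mem _ (eBar_pow_mem_strings m k))
      (S.smul_mem _ (sf _ (eBar_pow_mem_strings m _)))
  have sfb (k : ℕ) : fBar ((eBar ^ k) m) ∈ S := by
    rcases k with _ | k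
    · exact hf
    have h1 := (hm.eBar_pow k).fBar_eBar
    refine (S.smul_mem_iff (s := 4 * ((n + 2 * k : ℕ) + (3 : ℕ) : ℂ))
      (mul_ne_zero (by norm_num) (nat_add_ne_zero (n + 2 * k) 3 three_pos))).mp ?_
    rw [pow_succ', Module.End.mul_apply,
      show (4 * ((n + 2 * k : ℕ) + (3 : ℕ) : ℂ)) = 4 * (n + 2 * k) + 12 by push_cast; ring, h1,
      cBar_eBar_pow hχ, cMix_eBar_pow hc, map_smul, ← Module.End.mul_apply TakiffSl2.eBar,
      ← pow_succ']
    exact add_mem (sub_mem (S.smul_mem _ (S.smul_mem _ (eBar_pow_mem_strings m k)))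
      (S.smul_mem _ (sh k))) (S.smul_mem _ (sf _ (sh _)))
  refine smul_mem_of_generators S ?_ sf ?_ u hx
  · intro x hx
    induction hx using Submodule.span_induction with
    | zero => simp
    | add x y _ _ hx hy => rw [map_add]; exact add_mem hx hy
    | smul r x _ hx => rw [map_smul]; exact Submodule.smul_mem _ _ hx
    | mem x hx =>
      obtain ⟨⟨j, k⟩, rfl⟩ := hx
      rcases j with _ | j
      · simp [(hm.eBar_pow k).e]
      · rw [(hm.eBar_pow k).e_pow]; exact S.smul_mem _ (mem_strings m j k)
  · intro x hx
    induction hx using Submodule.span_induction with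
    | zero => simp
    | add x y _ _ hx hy => rw [map_add]; exact add_mem hx hy
    | smul r x _ hx => rw [map_smul]; exact Submodule.smul_mem _ _ hx
    | mem x hx =>
      obtain ⟨⟨j, k⟩, rfl⟩ := hx
      have h1 := eBar_pow_mem_strings m (k + 1)
      rw [pow_succ', Module.End.mul_apply] at h1
      exact (bar_pow_mem sf h1 (sh k) (sfb k) j).1

/-- For n > 0 the equation `lower n m = 0` can be solved for f̄ m. For n = 0 its coefficient at f̄ m
vanishes, and the invariance of m is used instead. -/
lemma fBar_mem_strings {m : M} {n : ℕ} {c : ℂ} (hm : IsHighest m n) (hc : cMix m = c • m)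
    (hl : lower n m = 0) (hf : n = 0 → fOp m = 0) : fBar m ∈ strings m := by
  have h1 : (fOp (eBar m)) ∈ strings m := mem_strings m 1 1
  have h2 : hBar m ∈ strings m := by
    refine ((strings m).smul_mem_iff (nat_add_ne_zero n 2 two_pos)).mp ?_
    have := hm.hBar
    push_cast
    rw [this, hc]
    exact sub_mem (Submodule.smul_mem _ _ (self_mem_strings m)) (Submodule.smul_mem _ _ h1)
  rcases Nat.eq_zero_or_pos n with h0 | h0
  · refine ((strings m).smul_mem_iff (two_ne_zero (α := ℂ))).mp ?_
    rw [fBar_of_invariant (hf h0)]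
    exact fOp_mem_strings h2
  · have hn : (n * (n + 1) : ℂ) ≠ 0 := by
      exact_mod_cast (Nat.mul_pos h0 n.succ_pos).ne'
    refine ((strings m).smul_mem_iff hn).mp ?_
    have : ((n : ℂ) * (n + 1)) • fBar m = ((n : ℂ) + 1) • fOp (hBar m) + fOp (fOp (eBar m)) := by
      rw [lower] at hl
      linear_combination (norm := module) hl
    rw [this]
    exact add_mem (Submodule.smul_mem _ _ (fOp_mem_strings h2)) (fOp_mem_strings h1)

end Highest

/-! ### Linear algebra of diagonalizable operators -/

section Eigen

variable {M : Type*} [AddCommGroup M] [Module ℂ M]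

lemma mem_span_of_eigenvector {ι : Type*} {A : Module.End ℂ M} {b : ι → M} {ev : ι → ℂ}
    (hb : ∀ i, A (b i) = ev i • b i) {x : M} (hx : x ∈ Submodule.span ℂ (Set.range b)) {μ : ℂ}
    (hμ : A x = μ • x) : x ∈ Submodule.span ℂ (b '' {i | ev i = μ}) := by
  have h1 : Set.range b = b '' {i | ev i = μ} ∪ b '' {i | ev i ≠ μ} := by
    rw [← Set.image_union, ← Set.image_univ]; congr 1
    ext i; simp [em]
  rw [h1, Submodule.span_union] at hx
  obtain ⟨y, hy, z, hz, rfl⟩ := Submodule.mem_sup.mp hx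
  have hy' : y ∈ A.eigenspace μ := by
    refine Submodule.span_le.mpr ?_ hy
    rintro _ ⟨i, hi, rfl⟩
    exact Module.End.mem_eigenspace_iff.mpr (by rw [hb, hi])
  have hz' : z ∈ ⨆ (ν) (_ : ν ≠ μ), A.eigenspace ν := by
    refine Submodule.span_le.mpr ?_ hz
    rintro _ ⟨i, hi, rfl⟩
    exact Submodule.mem_iSup_of_mem (ev i) (Submodule.mem_iSup_of_mem hi
      (Module.End.mem_eigenspace_iff.mpr (hb i)))
  have hz'' : z ∈ A.eigenspace μ := by
    have := sub_mem (Module.End.mem_eigenspace_iff.mpr hμ) hy'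
    rwa [add_sub_cancel_left] at this
  have h0 : z = 0 := Submodule.disjoint_def.mp (A.eigenspaces_iSupIndep μ) z hz'' hz'
  rwa [h0, add_zero]

/-- The sum of the eigenspaces of `A` for the eigenvalues different from `μ`. -/
def coEigenspace (A : Module.End ℂ M) (μ : ℂ) : Submodule ℂ M :=
  ⨆ (ν) (_ : ν ≠ μ), A.eigenspace ν

lemma coEigenspace_le {A : Module.End ℂ M} {μ : ℂ} {S : Submodule ℂ M}
    (hS : ∀ ν x, ν ≠ μ → A x = ν • x → x ∈ S) : coEigenspace A μ ≤ S :=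
  iSup_le fun ν => iSup_le fun hν x hx => hS ν x hν (Module.End.mem_eigenspace_iff.mp hx)

lemma mem_coEigenspace {A : Module.End ℂ M} {μ ν : ℂ} (hν : ν ≠ μ) {x : M} (hx : A x = ν • x) :
    x ∈ coEigenspace A μ :=
  Submodule.mem_iSup_of_mem ν (Submodule.mem_iSup_of_mem hν (Module.End.mem_eigenspace_iff.mpr hx))

lemma sub_mem_coEigenspace {A : Module.End ℂ M} {μ : ℂ} {x : M} (hx : x ∈ coEigenspace A μ) :
    A x - μ • x ∈ coEigenspace A μ := by
  refine (coEigenspace_le (S := (coEigenspace A μ).comap (A - μ • LinearMap.id)) ?_) hx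
  intro ν x hν hx
  change A x - μ • x ∈ coEigenspace A μ
  rw [hx, ← sub_smul]
  exact Submodule.smul_mem _ _ (mem_coEigenspace hν hx)

lemma exists_sub_eq_of_mem_coEigenspace {A : Module.End ℂ M} {μ : ℂ} {x : M}
    (hx : x ∈ coEigenspace A μ) : ∃ y, A y - μ • y = x := by
  refine (coEigenspace_le (S := LinearMap.range (A - μ • LinearMap.id)) ?_) hx
  intro ν x hν hx
  refine ⟨(ν - μ)⁻¹ • x, ?_⟩
  change A ((ν - μ)⁻¹ • x) - μ • (ν - μ)⁻¹ • x = x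
  rw [map_smul, hx]
  have : ν - μ ≠ 0 := sub_ne_zero.mpr hν
  rw [smul_comm (ν - μ)⁻¹, ← sub_smul, smul_comm, inv_smul_smul₀ this]

/-- A diagonalizable endomorphism. -/
def IsDiagonalizable (A : Module.End ℂ M) : Prop := Submodule.span ℂ {x | ∃ ν : ℂ, A x = ν • x} = ⊤

lemma IsDiagonalizable.exists_add {A : Module.End ℂ M} (hA : IsDiagonalizable A) (μ : ℂ) (x : M) :
    ∃ y z, A y = μ • y ∧ z ∈ coEigenspace A μ ∧ x = y + z := by
  have hx : x ∈ Submodule.span ℂ {x | ∃ ν : ℂ, A x = ν • x} := by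
    rw [show Submodule.span ℂ {x | ∃ ν : ℂ, A x = ν • x} = ⊤ from hA]; trivial
  induction hx using Submodule.span_induction with
  | zero => exact ⟨0, 0, by simp⟩
  | add x x' _ _ h1 h2 =>
    obtain ⟨y, z, hy, hz, rfl⟩ := h1
    obtain ⟨y', z', hy', hz', rfl⟩ := h2
    exact ⟨y + y', z + z', by rw [map_add, hy, hy', smul_add], add_mem hz hz', by abel⟩
  | smul r x _ h1 =>
    obtain ⟨y, z, hy, hz, rfl⟩ := h1
    exact ⟨r • y, r • z, by rw [map_smul, hy, smul_comm], Submodule.smul_mem _ _ hz, smul_add _ _ _⟩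
  | mem x hx =>
    obtain ⟨ν, hν⟩ := hx
    by_cases h : ν = μ
    · exact ⟨x, 0, by rw [hν, h], zero_mem _, (add_zero x).symm⟩
    · exact ⟨0, x, by simp, mem_coEigenspace h hν, (zero_add x).symm⟩

/-- Kernel and image of A - μ meet only in 0, since A has no Jordan blocks. -/
lemma IsDiagonalizable.eq_zero {A : Module.End ℂ M} (hA : IsDiagonalizable A) {μ : ℂ} {x y : M}
    (hxy : A y - μ • y = x) (hx : A x = μ • x) : x = 0 := by
  obtain ⟨y₀, z, h0, hz, rfl⟩ := hA.exists_add μ y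
  have : A z - μ • z = x := by rw [← hxy, map_add, h0]; module
  refine Submodule.disjoint_def.mp (A.eigenspaces_iSupIndep μ) x
    (Module.End.mem_eigenspace_iff.mpr hx) ?_
  rw [← this]; exact sub_mem_coEigenspace hz

end Eigen

/-! ### Finite-dimensional 𝔤-strings and lifting of highest weight vectors -/

section Strings

variable {M : Type*} [AddCommGroup M] [Module ℂ M] [Module U M] [IsScalarTower ℂ U M]

/-- Since e f^(k+1) w = (k+1)(μ-k) fᵏ w, vanishing descends one power at a time as long as μ ≠ k. -/
lemma IsHighest.pow_eq_zero {w : M} {μ : ℂ} (hw : IsHighest w μ) {a p : ℕ} (hap : a ≤ p)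
    (hμ : ∀ k : ℕ, a ≤ k → μ ≠ k) (hp : (fOp ^ p) w = 0) : (fOp ^ a) w = 0 := by
  induction p, hap using Nat.le_induction with
  | base => exact hp
  | succ p hap ih =>
    apply ih
    have := hw.e_pow p
    rw [hp, map_zero] at this
    refine (smul_eq_zero.mp this.symm).resolve_left (mul_ne_zero (Nat.cast_add_one_ne_zero p) ?_)
    exact sub_ne_zero.mpr (hμ p hap)

lemma IsHighest.eq_zero {w : M} {μ : ℂ} (hw : IsHighest w μ) (hμ : ∀ k : ℕ, μ ≠ k)
    (hp : ∃ p, (fOp ^ p) w = 0) : w = 0 := by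
  obtain ⟨p, hp⟩ := hp
  exact hw.pow_eq_zero (Nat.zero_le p) (fun k _ => hμ k) hp

lemma pow_eq_zero_of_le {w : M} {p q : ℕ} (hpq : p ≤ q) (hp : (fOp ^ p) w = 0) :
    (fOp ^ q) w = 0 := by
  obtain ⟨d, rfl⟩ := Nat.exists_eq_add_of_le' hpq
  rw [pow_add, Module.End.mul_apply, hp, map_zero]

lemma IsHighest.pow_succ_eq_zero {w : M} {n : ℕ} (hw : IsHighest w n)
    (hp : ∃ p, (fOp ^ p) w = 0) : (fOp ^ (n + 1)) w = 0 := by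
  obtain ⟨p, hp⟩ := hp
  refine hw.pow_eq_zero (p := p + (n + 1)) (by omega) (fun k hk => ?_)
    (pow_eq_zero_of_le (by omega) hp)
  exact_mod_cast (by omega : n ≠ k)

lemma IsHighest.eq_zero_of_pow {w : M} {n : ℕ} (hw : IsHighest w n) {p : ℕ} (hpn : p ≤ n)
    (hp : (fOp ^ p) w = 0) : w = 0 := by
  induction p with
  | zero => exact hp
  | succ p ih =>
    apply ih (by omega)
    have := hw.e_pow p
    rw [hp, map_zero] at this
    refine (smul_eq_zero.mp this.symm).resolve_left (mul_ne_zero (Nat.cast_add_one_ne_zero p) ?_)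
    exact sub_ne_zero.mpr (by exact_mod_cast (by omega : n ≠ p))

/-- The binomial formula for powers of ad f stops here because (ad f)³ ē = 0. It makes f locally
nilpotent on ē x once it is so on x. -/
lemma f_pow_eBar (x : M) (k : ℕ) : (fOp ^ (k + 2)) (eBar x) = eBar ((fOp ^ (k + 2)) x) -
    (k + 2 : ℂ) • hBar ((fOp ^ (k + 1)) x) - ((k + 1) * (k + 2) : ℂ) • fBar ((fOp ^ k) x) := by
  induction k with
  | zero =>
    simp only [pow_succ, pow_zero, one_mul, Module.End.mul_apply, Module.End.one_apply, zero_add,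
      eBar_f, hBar_f, map_add]
    push_cast; module
  | succ k ih =>
    rw [show k + 1 + 2 = (k + 2) + 1 by ring, pow_succ', Module.End.mul_apply, ih]
    simp only [pow_succ', Module.End.mul_apply, map_sub, map_smul, eBar_f, hBar_f, fBar_f]
    push_cast; module

lemma f_nilpotent_eBar {x : M} (hx : ∃ p, (fOp ^ p) x = 0) : ∃ p, (fOp ^ p) (eBar x) = 0 := by
  obtain ⟨p, hp⟩ := hx
  refine ⟨p + 2, ?_⟩
  rw [f_pow_eBar, hp, pow_eq_zero_of_le (p.le_add_right 1) hp,
    pow_eq_zero_of_le (p.le_add_right 2) hp]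
  simp

variable (M) in
/-- `f` acts locally nilpotently. -/
def FNilpotent : Prop := ∀ x : M, ∃ p, (fOp ^ p) x = 0

lemma fNilpotent_of_span {S : Set M} (hS : Submodule.span ℂ S = ⊤)
    (h : ∀ x ∈ S, ∃ p, (fOp ^ p) x = 0) : FNilpotent M := by
  intro x
  have hx : x ∈ Submodule.span ℂ S := hS ▸ Submodule.mem_top
  induction hx using Submodule.span_induction with
  | zero => exact ⟨0, by simp⟩
  | mem x hx => exact h x hx
  | smul r x _ h1 =>
    obtain ⟨p, hp⟩ := h1
    exact ⟨p, by rw [map_smul, hp, smul_zero]⟩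
  | add x y _ _ h1 h2 =>
    obtain ⟨p, hp⟩ := h1
    obtain ⟨q, hq⟩ := h2
    exact ⟨p + q, by rw [map_add, pow_eq_zero_of_le (p.le_add_right q) hp,
      pow_eq_zero_of_le (q.le_add_left p) hq, add_zero]⟩

/-- The vectors `fʲ w` with `j ≤ N`, where `w` is of highest weight `N` and `f ^ (N + 1) w = 0`. -/
def IsStringVector (x : M) : Prop :=
  ∃ (w : M) (N j : ℕ), IsHighest w N ∧ (fOp ^ (N + 1)) w = 0 ∧ j ≤ N ∧ x = (fOp ^ j) w

variable (M) in
/-- `M` is spanned by the vectors in finite-dimensional `𝔤`-strings. -/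
def IsStringSpanned : Prop := Submodule.span ℂ {x : M | IsStringVector x} = ⊤

namespace IsStringSpanned

lemma fNilpotent (hM : IsStringSpanned M) : FNilpotent M := by
  refine fNilpotent_of_span hM ?_
  rintro _ ⟨w, N, j, _, h0, _, rfl⟩
  refine ⟨N + 1, ?_⟩
  rw [← Module.End.mul_apply, ← pow_add]
  exact pow_eq_zero_of_le (by omega) h0

lemma isDiagonalizable (hM : IsStringSpanned M) : IsDiagonalizable (hOp : M →ₗ[ℂ] M) := by
  refine top_unique ((show Submodule.span ℂ {x : M | IsStringVector x} = ⊤ from hM).ge.trans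
    (Submodule.span_mono ?_))
  rintro _ ⟨w, N, j, hw, _, _, rfl⟩
  exact ⟨_, hw.h_pow j⟩

/-- Surjectivity of e from weight n to weight n + 2: a string vector fʲ w of weight n + 2 has N = n
+ 2 + 2j, so e f^(j+1) w = (j+1)(N-j) fʲ w with a nonzero factor. -/
lemma exists_e_eq (hM : IsStringSpanned M) {n : ℕ} {y : M} (hy : hOp y = (n + 2 : ℂ) • y) :
    ∃ x, hOp x = (n : ℂ) • x ∧ eOp x = y := by
  choose w N j hw h0 hj hx using fun x : {x : M // IsStringVector x} => x.2
  have hspan : y ∈ Submodule.span ℂ (Set.range (Subtype.val : {x : M // IsStringVector x} → M)) := by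
    have h1 : Submodule.span ℂ {x : M | IsStringVector x} = ⊤ := hM
    have h2 : Set.range (Subtype.val : {x : M // IsStringVector x} → M) =
      {x : M | IsStringVector x} := Subtype.range_coe
    rw [h2, h1]; trivial
  have h1 := mem_span_of_eigenvector (A := hOp) (ev := fun i => N i - 2 * j i)
    (fun i => by rw [hx i]; exact (hw i).h_pow _) hspan hy
  refine (Submodule.span_le (p := (Module.End.eigenspace hOp (n : ℂ)).map eOp)).mpr ?_ h1 |>.imp
    fun x hx => ⟨Module.End.mem_eigenspace_iff.mp hx.1, hx.2⟩
  rintro _ ⟨i, hi, rfl⟩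
  have hi' : (N i : ℂ) = n + 2 + 2 * j i := by
    have : (N i : ℂ) - 2 * j i = n + 2 := hi
    linear_combination this
  have hN : N i = n + 2 + 2 * j i := by exact_mod_cast hi'
  have hne : ((j i + 1) * (N i - j i) : ℂ) ≠ 0 := by
    rw [hi', show ((j i + 1) * (n + 2 + 2 * j i - j i) : ℂ) = ((j i + 1) * (n + 2 + j i) : ℕ) by
      push_cast; ring]
    exact_mod_cast (by positivity)
  refine ⟨((j i + 1) * (N i - j i) : ℂ)⁻¹ • (fOp ^ (j i + 1)) (w i), ?_, ?_⟩
  · refine Submodule.smul_mem _ _ (Module.End.mem_eigenspace_iff.mpr ?_)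
    rw [(hw i).h_pow]; congr 1; rw [hi']; push_cast; ring
  · rw [map_smul, (hw i).e_pow, inv_smul_smul₀ hne]; exact (hx i).symm

end IsStringSpanned

/-- Here m need not be a weight vector; this is applied before h is known to act on the lift by a
scalar. -/
lemma e_pow_apply (m : M) (k : ℕ) : eOp ((fOp ^ (k + 1)) m) =
    (fOp ^ (k + 1)) (eOp m) + (k + 1 : ℂ) • (fOp ^ k) (hOp m - (k : ℂ) • m) := by
  induction k with
  | zero => simp [e_f]
  | succ k ih =>
    have hf (k : ℕ) (x : M) : hOp ((fOp ^ k) x) = (fOp ^ k) (hOp x) - (2 * k : ℂ) • (fOp ^ k) x := by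
      induction k with
      | zero => simp
      | succ k ih => simp only [pow_succ', Module.End.mul_apply, h_f, ih, map_sub, map_smul]
                     push_cast; module
    rw [pow_succ' _ (k + 1), Module.End.mul_apply, e_f, ih, hf]
    simp only [pow_succ', Module.End.mul_apply, map_sub, map_smul, map_add]
    push_cast; module

/-- Highest weight vectors lift along extensions by string-spanned modules. -/
theorem exists_highest_lift {V : Type*} [AddCommGroup V] [Module ℂ V] [Module U V]
    [IsScalarTower ℂ U V] (hV : IsStringSpanned V) (hM : FNilpotent M) (i : V →ₗ[U] M)
    (hi : Function.Injective i) {n : ℕ} {m : M} (he : ∃ y, eOp m = i y)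
    (hh : ∃ x, hOp m - (n : ℂ) • m = i x) :
    ∃ x, IsHighest (m - i x) n ∧ (fOp ^ (n + 1)) (m - i x) = 0 := by
  have ic (r : ℂ) (x : V) : i (r • x) = r • i x := by
    rw [← algebraMap_smul U r x, map_smul, algebraMap_smul]
  have ie (x : V) : i (eOp x) = eOp (i x) := i.map_smul _ _
  have ih (x : V) : i (hOp x) = hOp (i x) := i.map_smul _ _
  have iff' (x : V) : i (fOp x) = fOp (i x) := i.map_smul _ _
  have ifp (k : ℕ) (x : V) : i ((fOp ^ k) x) = (fOp ^ k) (i x) := by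
    induction k with
    | zero => rfl
    | succ k ih => rw [pow_succ', pow_succ', Module.End.mul_apply, iff', ih, Module.End.mul_apply]
  obtain ⟨y, hy⟩ := he
  obtain ⟨x, hx⟩ := hh
  obtain ⟨x₀, z, hx₀, hz, rfl⟩ := hV.isDiagonalizable.exists_add n x
  obtain ⟨x₁, rfl⟩ := exists_sub_eq_of_mem_coEigenspace hz
  -- correct `m` by `x₁`
  set m₁ := m - i x₁ with hm₁
  have h1 : hOp m₁ = (n : ℂ) • m₁ + i x₀ := by
    rw [hm₁, map_sub, ← ih]
    have : hOp m = (n : ℂ) • m + i (x₀ + (hOp x₁ - (n : ℂ) • x₁)) := by rw [← hx]; abel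
    rw [this, map_add, map_sub, ic]; module
  set y₁ := y - eOp x₁ with hy₁
  have h2 : eOp m₁ = i y₁ := by rw [hm₁, map_sub, hy, hy₁, map_sub, ie]
  -- The defect e x₀ is an eigenvector for n + 2 and lies in the image of h - (n + 2), hence
  -- vanishes.
  have h3 : hOp y₁ - (n + 2 : ℂ) • y₁ = eOp x₀ := by
    apply hi
    rw [map_sub, ih, ic, ie, ← h2, h_e, h1, map_add, map_smul]; module
  have h4 : hOp (eOp x₀) = (n + 2 : ℂ) • eOp x₀ := by rw [h_e, hx₀, map_smul]; module
  have h5 : eOp x₀ = 0 := hV.isDiagonalizable.eq_zero h3 h4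
  rw [h5] at h3
  -- Now e m₁ comes from a vector of weight n + 2, so a correction of weight n removes it without
  -- changing the defect x₀ of h.
  obtain ⟨x₂, hx₂, hex₂⟩ := hV.exists_e_eq (sub_eq_zero.mp h3)
  have hw : IsHighest x₀ n := ⟨h5, hx₀⟩
  set m₂ := m₁ - i x₂ with hm₂
  have h6 : eOp m₂ = 0 := by rw [hm₂, map_sub, h2, ← ie, hex₂, sub_self]
  have h7 : hOp m₂ = (n : ℂ) • m₂ + i x₀ := by rw [hm₂, map_sub, h1, ← ih, hx₂, ic]; module
  -- Because f^(n+1) x₀ = 0, nilpotency of f on m₂ descends to the power n + 1. At k = n the factor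
  -- n - k vanishes, which forces fⁿ x₀ = 0 and then x₀ = 0.
  have key (k : ℕ) : eOp ((fOp ^ (k + 1)) m₂) =
      (k + 1 : ℂ) • ((n - k : ℂ) • (fOp ^ k) m₂ + i ((fOp ^ k) x₀)) := by
    rw [e_pow_apply, h6, h7, ifp]
    simp only [map_sub, map_add, map_smul, map_zero]; module
  have h8 : (fOp ^ (n + 1)) x₀ = 0 := hw.pow_succ_eq_zero (hV.fNilpotent x₀)
  have h9 : (fOp ^ (n + 1)) m₂ = 0 := by
    obtain ⟨p, hp⟩ := hM m₂
    have hp' := pow_eq_zero_of_le (p.le_add_left (n + 1)) hp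
    clear hp
    induction p with
    | zero => exact hp'
    | succ p ih =>
      apply ih
      have := key (n + 1 + p)
      rw [show n + 1 + p + 1 = n + 1 + (p + 1) by ring, hp',
        pow_eq_zero_of_le ((n + 1).le_add_right p) h8, map_zero, map_zero, add_zero,
        smul_smul] at this
      refine (smul_eq_zero.mp this.symm).resolve_left (mul_ne_zero ?_ ?_)
      · exact Nat.cast_add_one_ne_zero _
      · exact sub_ne_zero.mpr (by exact_mod_cast (by omega : n ≠ n + 1 + p))
  have h10 : x₀ = 0 := by
    have := key n
    rw [h9, map_zero, sub_self, zero_smul, zero_add] at this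
    have := (smul_eq_zero.mp this.symm).resolve_left (Nat.cast_add_one_ne_zero _)
    exact hw.eq_zero_of_pow le_rfl (hi (by rw [this, map_zero]))
  refine ⟨x₁ + x₂, ?_⟩
  have : m - i (x₁ + x₂) = m₂ := by rw [hm₂, hm₁, map_add]; abel
  rw [this]
  exact ⟨⟨h6, by rw [h7, h10, map_zero, add_zero]⟩, h9⟩

end Strings

/-! ### Compatibility with homomorphisms -/

section Maps

variable {M N : Type*} [AddCommGroup M] [Module ℂ M] [Module U M] [IsScalarTower ℂ U M]
  [AddCommGroup N] [Module ℂ N] [Module U N] [IsScalarTower ℂ U N] (φ : M →ₗ[U] N)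

include φ in
lemma map_complex_smul (r : ℂ) (x : M) : φ (r • x) = r • φ x :=
  (φ.restrictScalars ℂ).map_smul r x

lemma map_eOp (x : M) : φ (eOp x) = eOp (φ x) := φ.map_smul _ _
lemma map_fOp (x : M) : φ (fOp x) = fOp (φ x) := φ.map_smul _ _
lemma map_hOp (x : M) : φ (hOp x) = hOp (φ x) := φ.map_smul _ _
lemma map_eBar (x : M) : φ (eBar x) = eBar (φ x) := φ.map_smul _ _
lemma map_fBar (x : M) : φ (fBar x) = fBar (φ x) := φ.map_smul _ _
lemma map_hBar (x : M) : φ (hBar x) = hBar (φ x) := φ.map_smul _ _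

lemma map_cMix (x : M) : φ (cMix x) = cMix (φ x) := by
  simp only [cMix_apply, map_add, map_complex_smul, map_hOp, map_eOp, map_fOp, map_eBar, map_fBar,
    map_hBar]

lemma map_lower (n : ℂ) (x : M) : φ (lower n x) = lower n (φ x) := by
  simp only [lower, map_sub, map_complex_smul, map_fOp, map_eBar, map_fBar, map_hBar]

lemma map_f_pow (k : ℕ) (x : M) : φ ((fOp ^ k) x) = (fOp ^ k) (φ x) := by
  induction k with
  | zero => rfl
  | succ k ih => rw [pow_succ', pow_succ', Module.End.mul_apply, map_fOp, ih, Module.End.mul_apply]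

lemma map_eBar_pow (k : ℕ) (x : M) : φ ((eBar ^ k) x) = (eBar ^ k) (φ x) := by
  induction k with
  | zero => rfl
  | succ k ih => rw [pow_succ', pow_succ', Module.End.mul_apply, map_eBar, ih, Module.End.mul_apply]

lemma IsHighest.of_map {φ : M →ₗ[U] N} (hφ : Function.Injective φ) {x : M} {μ : ℂ}
    (hx : IsHighest (φ x) μ) : IsHighest x μ :=
  ⟨hφ (by rw [map_eOp, hx.e, map_zero]), hφ (by rw [map_hOp, hx.h, map_complex_smul])⟩

lemma FNilpotent.extension {V : Type*} [AddCommGroup V] [Module ℂ V] [Module U V]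
    [IsScalarTower ℂ U V] {i : V →ₗ[U] M} {p : M →ₗ[U] N} (hip : Function.Exact i p)
    (hV : FNilpotent V) (hN : FNilpotent N) : FNilpotent M := by
  intro x
  obtain ⟨k, hk⟩ := hN (p x)
  rw [← map_f_pow] at hk
  obtain ⟨y, hy⟩ := (hip _).mp hk
  obtain ⟨l, hl⟩ := hV y
  refine ⟨l + k, ?_⟩
  rw [pow_add, Module.End.mul_apply, ← hy, ← map_f_pow, hl, map_zero]

end Maps

/-! ### Structure of the simple modules and rigidity of their generators -/

section Structure

variable {V : Type*} [AddCommGroup V] [Module ℂ V] [Module U V] [IsScalarTower ℂ U V]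

/-- `V` is generated by `v`, which has highest weight `n` and is an eigenvector of the center. -/
structure IsGenerator (v : V) (n : ℕ) (c χ : ℂ) : Prop where
  highest : IsHighest v n
  nilpotent : (fOp ^ (n + 1)) v = 0
  cMix : cMix v = c • v
  cBar : cBar v = χ • v
  span : strings v = ⊤

/-- An endomorphism that separates the vectors `fʲ ēᵏ v`. -/
def separator : V →ₗ[ℂ] V := casimir + Complex.I • hOp

lemma IsHighest.separator_pow {w : V} {N : ℂ} (hw : IsHighest w N) (j : ℕ) :
    separator ((fOp ^ j) w) = ((N + 1) ^ 2 + Complex.I * (N - 2 * j)) • (fOp ^ j) w := by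
  change casimir ((fOp ^ j) w) + Complex.I • hOp ((fOp ^ j) w) = _
  rw [hw.casimir_pow, hw.h_pow]; module

/-- The real part gives (N + 1)², which determines N because N + 1 > 0; the imaginary part gives the
weight. One operator thus replaces simultaneous eigenvalues of `casimir` and h. -/
lemma separator_injective {N N' : ℕ} {a b : ℤ}
    (h : ((N : ℂ) + 1) ^ 2 + Complex.I * a = ((N' : ℂ) + 1) ^ 2 + Complex.I * b) :
    N = N' ∧ a = b := by
  have h1 := congrArg Complex.re h
  have h2 := congrArg Complex.im h
  simp only [pow_two, Complex.add_re, Complex.mul_re, Complex.add_im, Complex.mul_im,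
    Complex.natCast_re, Complex.natCast_im, Complex.one_re, Complex.one_im, Complex.I_re,
    Complex.I_im, Complex.intCast_re, Complex.intCast_im] at h1 h2
  have h1' : ((N : ℝ) + 1) ^ 2 = ((N' : ℝ) + 1) ^ 2 := by linarith
  have h3 : (N : ℝ) + 1 = N' + 1 := (pow_left_inj₀ (by positivity) (by positivity) two_ne_zero).mp h1'
  exact ⟨by exact_mod_cast add_right_cancel h3, by exact_mod_cast (by linarith : (a : ℝ) = b)⟩

lemma separator_strings {v : V} {n : ℕ} (hv : IsHighest v n) (p : ℕ × ℕ) :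
    separator ((fOp ^ p.1) ((eBar ^ p.2) v)) = (((n + 2 * p.2 : ℕ) + 1 : ℂ) ^ 2 +
      Complex.I * ((n + 2 * p.2 - 2 * p.1 : ℤ) : ℂ)) • (fOp ^ p.1) ((eBar ^ p.2) v) := by
  rw [(hv.eBar_pow p.2).separator_pow]; congr 1; push_cast; ring

/-- A vector of the span of the vectors `fʲ ēᵏ v` which is a highest weight vector of weight `N`. -/
lemma mem_span_of_isHighest {v : V} {n : ℕ} (hv : IsHighest v n) {x : V} (hx : x ∈ strings v)
    {N : ℕ} (hN : IsHighest x N) :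
    x ∈ Submodule.span ℂ ((fun p : ℕ × ℕ => (fOp ^ p.1) ((eBar ^ p.2) v)) ''
      {p | n + 2 * p.2 = N ∧ p.1 = 0}) := by
  have h1 := hN.separator_pow 0
  rw [pow_zero, Module.End.one_apply] at h1
  have := mem_span_of_eigenvector (separator_strings hv) hx h1
  refine Submodule.span_mono (Set.image_mono ?_) this
  intro p hp
  have h2 := separator_injective (N' := N) (b := N) (hp.trans (by push_cast; ring))
  exact ⟨h2.1, by omega⟩

lemma f_nilpotent_eBar_pow {v : V} (hv : ∃ p, (fOp ^ p) v = 0) (k : ℕ) :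
    ∃ p, (fOp ^ p) ((eBar ^ k) v) = 0 := by
  induction k with
  | zero => exact hv
  | succ k ih => rw [pow_succ', Module.End.mul_apply]; exact f_nilpotent_eBar ih

lemma f_pow_eBar_pow_eq_zero {v : V} {n : ℕ} (hv : IsHighest v n) (h0 : ∃ p, (fOp ^ p) v = 0)
    {j k : ℕ} (hj : n + 2 * k < j) : (fOp ^ j) ((eBar ^ k) v) = 0 := by
  have h1 := hv.eBar_pow k
  rw [show (n + 2 * k : ℂ) = ((n + 2 * k : ℕ) : ℂ) by push_cast; rfl] at h1
  exact pow_eq_zero_of_le hj (h1.pow_succ_eq_zero (f_nilpotent_eBar_pow h0 k))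

lemma strings_eq_span {v : V} {n : ℕ} (hv : IsHighest v n) (h0 : ∃ p, (fOp ^ p) v = 0) :
    strings v = Submodule.span ℂ (Set.range fun p : {p : ℕ × ℕ // p.1 ≤ n + 2 * p.2} =>
      (fOp ^ p.1.1) ((eBar ^ p.1.2) v)) := by
  apply le_antisymm
  · refine Submodule.span_le.mpr ?_
    rintro _ ⟨p, rfl⟩
    by_cases hp : p.1 ≤ n + 2 * p.2
    · exact Submodule.subset_span ⟨⟨p, hp⟩, rfl⟩
    · have := f_pow_eBar_pow_eq_zero hv h0 (not_le.mp hp)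
      change (fOp ^ p.1) ((eBar ^ p.2) v) ∈ _
      rw [this]; exact zero_mem _
  · refine Submodule.span_mono ?_
    rintro _ ⟨p, rfl⟩
    exact ⟨p.1, rfl⟩

/-- These are eigenvectors of `separator` for distinct eigenvalues; they are nonzero since fʲ kills
no nonzero vector of highest weight N for j ≤ N. -/
lemma linearIndependent_strings {v : V} {n : ℕ} (hv : IsHighest v n)
    (hne : ∀ k : ℕ, (eBar ^ k) v ≠ 0) :
    LinearIndependent ℂ fun p : {p : ℕ × ℕ // p.1 ≤ n + 2 * p.2} =>
      (fOp ^ p.1.1) ((eBar ^ p.1.2) v) := by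
  refine Module.End.eigenvectors_linearIndependent' (separator : V →ₗ[ℂ] V)
    (fun p => (((n + 2 * p.1.2 : ℕ) + 1 : ℂ) ^ 2 +
      Complex.I * ((n + 2 * p.1.2 - 2 * p.1.1 : ℤ) : ℂ))) ?_ _ ?_
  · intro p q hpq
    have := separator_injective hpq
    exact Subtype.ext (Prod.ext (by omega) (by omega))
  · intro p
    refine ⟨Module.End.mem_eigenspace_iff.mpr (separator_strings hv p.1), fun h0 => hne p.1.2 ?_⟩
    have h1 := hv.eBar_pow p.1.2
    rw [show (n + 2 * p.1.2 : ℂ) = ((n + 2 * p.1.2 : ℕ) : ℂ) by push_cast; rfl] at h1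
    exact h1.eq_zero_of_pow p.2 h0

namespace IsGenerator

variable {v : V} {n : ℕ} {c χ : ℂ}

lemma fNilpotent (hv : IsGenerator v n c χ) : FNilpotent V := by
  refine fNilpotent_of_span hv.span ?_
  rintro _ ⟨⟨j, k⟩, rfl⟩
  obtain ⟨p, hp⟩ := f_nilpotent_eBar_pow ⟨_, hv.nilpotent⟩ k
  refine ⟨p, ?_⟩
  rw [← Module.End.mul_apply, ← pow_add]
  exact pow_eq_zero_of_le (by omega) hp

lemma isStringSpanned (hv : IsGenerator v n c χ) : IsStringSpanned V := by
  refine top_unique (hv.span.ge.trans ?_)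
  rw [strings_eq_span hv.highest ⟨_, hv.nilpotent⟩]
  refine Submodule.span_mono ?_
  rintro _ ⟨⟨⟨j, k⟩, hp⟩, rfl⟩
  have h1 := hv.highest.eBar_pow k
  rw [show (n + 2 * k : ℂ) = ((n + 2 * k : ℕ) : ℂ) by push_cast; rfl] at h1
  exact ⟨_, n + 2 * k, j, h1, h1.pow_succ_eq_zero (hv.fNilpotent _), hp, rfl⟩

lemma eq_smul (hv : IsGenerator v n c χ) {x : V} (hx : IsHighest x n) : ∃ a : ℂ, x = a • v := by
  have h1 := mem_span_of_isHighest hv.highest (hv.span ▸ Submodule.mem_top) hx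
  have : (fun p : ℕ × ℕ => (fOp ^ p.1) ((eBar ^ p.2) v)) '' {p | n + 2 * p.2 = n ∧ p.1 = 0} ⊆
      {v} := by
    rintro _ ⟨⟨j, k⟩, ⟨hk, hj⟩, rfl⟩
    obtain rfl : k = 0 := by simpa using hk
    obtain rfl : j = 0 := hj
    rfl
  obtain ⟨a, ha⟩ := Submodule.mem_span_singleton.mp (Submodule.span_mono this h1)
  exact ⟨a, ha.symm⟩

lemma eq_zero_of_isHighest (hv : IsGenerator v n c χ) {x : V} {N : ℕ} (hN : N < n)
    (hx : IsHighest x N) : x = 0 := by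
  have h1 := mem_span_of_isHighest hv.highest (hv.span ▸ Submodule.mem_top) hx
  have : {p : ℕ × ℕ | n + 2 * p.2 = N ∧ p.1 = 0} = ∅ := by
    ext p; simp only [Set.mem_ofPred_eq, Set.mem_empty_iff_false, iff_false]; omega
  rwa [this, Set.image_empty, Submodule.span_empty, Submodule.mem_bot] at h1

end IsGenerator

/-- For n ≥ 2 minimality applies to n - 2; for n = 0, 1 the weight is negative, which local
nilpotency of f excludes. -/
lemma eq_zero_of_isHighest_sub_two {x : V} {n : ℕ} (hx : IsHighest x (n - 2))
    (hmin : ∀ N < n, ∀ x : V, IsHighest x N → x = 0) (hf : ∃ p, (fOp ^ p) x = 0) : x = 0 := by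
  by_cases hn : 2 ≤ n
  · obtain ⟨k, rfl⟩ := Nat.exists_eq_add_of_le' hn
    exact hmin k (by omega) x (by simpa using hx)
  · refine hx.eq_zero (fun k hk => ?_) hf
    have h1 : (n : ℂ) = (k + 2 : ℕ) := by push_cast; linear_combination hk
    have h2 : n = k + 2 := by exact_mod_cast h1
    omega

namespace IsGenerator

variable {v : V} {n : ℕ} {c χ : ℂ}

lemma eq_zero (hv : IsGenerator v n c χ) {x : V} (hx : IsHighest x (n - 2)) : x = 0 :=
  eq_zero_of_isHighest_sub_two hx (fun _ hN _ => hv.eq_zero_of_isHighest hN) (hv.fNilpotent x)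

lemma lower_eq_zero (hv : IsGenerator v n c χ) : lower n v = 0 := hv.eq_zero hv.highest.lower

lemma sq_eq (hv : IsGenerator v n c χ) (h0 : v ≠ 0) : c ^ 2 = n ^ 2 * χ := by
  have := cMix_cMix (by exact_mod_cast nat_add_ne_zero n 2 two_pos) hv.highest hv.lower_eq_zero
  rw [hv.cMix, map_smul, hv.cMix, hv.cBar, smul_smul, smul_smul] at this
  rw [pow_two]; exact smul_left_injective ℂ h0 this

/-- A lift of the generator to a self-extension on which `C̄` acts by the same scalar
satisfies all relations of the generator. -/
theorem smul_eq_zero_of_lift (hv : IsGenerator v n c χ) (hne : ∀ k : ℕ, (eBar ^ k) v ≠ 0)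
    (hχ : χ ≠ 0) {M : Type*} [AddCommGroup M] [Module ℂ M] [Module U M] [IsScalarTower ℂ U M]
    {i : V →ₗ[U] M} {p : M →ₗ[U] V} (hi : Function.Injective i) (hip : Function.Exact i p)
    {m : M} (hm : IsHighest m n) (hf : (fOp ^ (n + 1)) m = 0) (hp : p m = v)
    (hc : TakiffSl2.cBar m = χ • m) {u : U} (hu : u • v = 0) : u • m = 0 := by
  have h0 : v ≠ 0 := hne 0
  -- `lower n m` projects to `lower n v = 0`, so it comes from V, which has no highest weight vector
  -- of weight n - 2.
  have hl : lower n m = 0 := by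
    have h1 : p (lower n m) = 0 := by rw [map_lower, hp, hv.lower_eq_zero]
    obtain ⟨z, hz⟩ := (hip _).mp h1
    rw [← hz, hv.eq_zero ((hz ▸ hm.lower : IsHighest (i z) _).of_map hi), map_zero]
  have hmix : TakiffSl2.cMix m = c • m := by
    have h1 : p (TakiffSl2.cMix m - c • m) = 0 := by
      rw [map_sub, map_cMix, map_complex_smul, hp, hv.cMix, sub_self]
    obtain ⟨y, hy⟩ := (hip _).mp h1
    have h2 : IsHighest (i y) n := by
      rw [hy]
      exact ⟨by rw [map_sub, hm.cMix.e, map_smul, hm.e]; simp, by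
        rw [map_sub, hm.cMix.h, map_smul, hm.h]; module⟩
    obtain ⟨b, rfl⟩ := hv.eq_smul (h2.of_map hi)
    have h3 : TakiffSl2.cMix m = c • m + b • i v := by
      rw [← map_complex_smul, hy]; abel
    -- It remains to see b = 0. For n > 0, comparing (c + b)-type terms in cMix² m = n²χ m leaves
    -- 2cb = 0, and c² = n²χ ≠ 0. For n = 0 that equation says nothing, but `cMix` kills invariants.
    rcases Nat.eq_zero_or_pos n with hn | hn
    · subst hn
      have hc0 : c = 0 := by simpa using hv.sq_eq h0
      rw [cMix_of_invariant (by simpa using hm) (by simpa using hf), hc0, zero_smul]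
    · have h4 := cMix_cMix (by exact_mod_cast nat_add_ne_zero n 2 two_pos) hm hl
      have hiv : TakiffSl2.cMix (i v) = c • i v := by rw [← map_cMix, hv.cMix, map_complex_smul]
      rw [h3, map_add, map_smul, map_smul, hiv, h3, hc, smul_smul _ χ, ← hv.sq_eq h0] at h4
      have h5 : (2 * c * b) • i v = 0 := by linear_combination (norm := module) h4
      have hc0 : c ≠ 0 := by
        intro hc0
        have := hv.sq_eq h0
        rw [hc0] at this
        have hn' : (n : ℂ) ≠ 0 := by exact_mod_cast hn.ne'
        simp [hn', hχ] at this
      have hb : b = 0 := by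
        rcases smul_eq_zero.mp h5 with h | h
        · simpa [hc0] using h
        · exact absurd (hi (h.trans (map_zero i).symm)) h0
      rw [h3, hb, zero_smul, add_zero]
  -- Write u m as a combination of the fʲ ēᵏ m. Its image u v = 0 is the same combination of
  -- independent vectors, so all coefficients vanish.
  have hmem := smul_mem_strings hm hmix hc
    (fBar_mem_strings hm hmix hl fun hn => by subst hn; simpa using hf) u (self_mem_strings m)
  rw [strings_eq_span hm ⟨_, hf⟩] at hmem
  obtain ⟨a, ha⟩ := Finsupp.mem_span_range_iff_exists_finsupp.mp hmem
  have h1 := congrArg p ha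
  rw [map_smul, hp, hu, Finsupp.sum, map_sum] at h1
  simp only [map_complex_smul, map_f_pow, map_eBar_pow, hp] at h1
  have h2 := linearIndependent_iff'.mp (linearIndependent_strings hv.highest hne) _ _ h1
  rw [← ha, Finsupp.sum]
  exact Finset.sum_eq_zero fun q hq => by rw [h2 q hq, zero_smul]

end IsGenerator

omit [IsScalarTower ℂ U V] in
lemma eq_top_of_isSimpleModule [IsSimpleModule U V] {S : Submodule ℂ V}
    (hS : ∀ (u : U), ∀ x ∈ S, u • x ∈ S) {x : V} (hx : x ∈ S) (h0 : x ≠ 0) : S = ⊤ := by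
  let T : Submodule U V := { S.toAddSubmonoid with smul_mem' := hS }
  have hT : T = ⊤ := (eq_bot_or_eq_top T).resolve_left fun h => h0 (by
    have : x ∈ T := hx
    rwa [h, Submodule.mem_bot] at this)
  refine eq_top_iff.mpr fun y _ => ?_
  have : y ∈ T := hT ▸ Submodule.mem_top
  exact this

/-- The structure of the infinite-dimensional simple Harish-Chandra modules. -/
theorem exists_isGenerator [IsSimpleModule U V] (hV : IsStringSpanned V)
    (hinf : ¬ FiniteDimensional ℂ V) {c χ : ℂ} (hc : ∀ x : V, cMix x = c • x)
    (hχ : ∀ x : V, cBar x = χ • x) :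
    ∃ (v : V) (n : ℕ), IsGenerator v n c χ ∧ (∀ k : ℕ, (eBar ^ k) v ≠ 0) ∧ χ ≠ 0 := by
  classical
  have hex : ∃ n : ℕ, ∃ w : V, w ≠ 0 ∧ IsHighest w n := by
    by_contra! hcon
    have : (⊤ : Submodule ℂ V) ≤ ⊥ := by
      rw [← show Submodule.span ℂ {x : V | IsStringVector x} = ⊤ from hV, Submodule.span_le]
      rintro _ ⟨w, N, j, hw, _, _, rfl⟩
      by_contra hx
      exact hcon N w (fun h0 => hx (by simp [h0])) hw
    have _ := IsSimpleModule.nontrivial U V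
    obtain ⟨x, hx⟩ := exists_ne (0 : V)
    exact hx (this Submodule.mem_top)
  obtain ⟨v, hv0, hv⟩ := Nat.find_spec hex
  have hmin : ∀ N < Nat.find hex, ∀ x : V, IsHighest x N → x = 0 := fun N hN x hx => by
    by_contra h
    exact Nat.find_min hex hN ⟨x, h, hx⟩
  set n := Nat.find hex with hn
  have hl : lower n v = 0 := eq_zero_of_isHighest_sub_two hv.lower hmin (hV.fNilpotent _)
  have hf := hv.pow_succ_eq_zero (hV.fNilpotent _)
  have hgen : IsGenerator v n c χ := ⟨hv, hf, hc v, hχ v, eq_top_of_isSimpleModule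
    (fun u x hx => smul_mem_strings hv (hc v) (hχ v)
      (fBar_mem_strings hv (hc v) hl fun hn => by rw [hn] at hf; simpa using hf) u hx)
    (self_mem_strings v) hv0⟩
  -- If ēᵏ v = 0, only finitely many of the spanning vectors are nonzero.
  have hne : ∀ k : ℕ, (eBar ^ k) v ≠ 0 := by
    intro k hk
    apply hinf
    have hfin : ({p : ℕ × ℕ | p.2 < k ∧ p.1 ≤ n + 2 * k}).Finite :=
      ((Set.finite_Iic (n + 2 * k)).prod (Set.finite_Iio k)).subset fun p hp => ⟨hp.2, hp.1⟩
    refine Module.finite_def.mpr ?_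
    rw [← hgen.span]
    refine Submodule.fg_def.mpr ⟨(fun p : ℕ × ℕ => (fOp ^ p.1) ((eBar ^ p.2) v)) '' _,
      hfin.image _, le_antisymm (Submodule.span_mono (Set.image_subset_range _ _)) ?_⟩
    refine Submodule.span_le.mpr ?_
    rintro _ ⟨p, rfl⟩
    by_cases h1 : p.2 < k ∧ p.1 ≤ n + 2 * k
    · exact Submodule.subset_span ⟨p, h1, rfl⟩
    · have : (fOp ^ p.1) ((eBar ^ p.2) v) = 0 := by
        by_cases h2 : p.2 < k
        · exact f_pow_eBar_pow_eq_zero hv ⟨_, hf⟩ (by omega)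
        · obtain ⟨d, hd⟩ := Nat.exists_eq_add_of_le' (not_lt.mp h2)
          rw [hd, pow_add, Module.End.mul_apply, hk, map_zero, map_zero]
      change (fOp ^ p.1) ((eBar ^ p.2) v) ∈ _
      rw [this]; exact zero_mem _
  refine ⟨v, n, hgen, hne, ?_⟩
  -- If χ = 0 then c = 0, and the strings of ē v are already stable. By simplicity ē v would
  -- generate V with lowest highest weight n + 2, leaving no room for v of weight n.
  rintro rfl
  have hc0 : c = 0 := by simpa using hgen.sq_eq hv0
  subst hc0
  have hv' : IsHighest (eBar v) ((n + 2 : ℕ) : ℂ) := by simpa using hv.eBar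
  have h1 : eBar v ≠ 0 := by simpa using hne 1
  have h2 : hBar (eBar v) ∈ strings (eBar v) := by
    have := hv'.hBar
    refine ((strings (eBar v)).smul_mem_iff (nat_add_ne_zero (n + 2) 2 two_pos)).mp ?_
    rw [hc, zero_smul, zero_sub] at this
    push_cast at this ⊢
    rw [this]
    exact neg_mem (Submodule.smul_mem _ _ (mem_strings (eBar v) 1 1))
  have h3 : fBar (eBar v) ∈ strings (eBar v) := by
    have := hv.fBar_eBar
    refine ((strings (eBar v)).smul_mem_iff
      (s := (4 * n + 12 : ℂ)) (by exact_mod_cast (by omega : 4 * n + 12 ≠ 0))).mp ?_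
    rw [this, hχ, hc, zero_smul, map_zero, smul_zero, sub_zero, zero_add]
    exact Submodule.smul_mem _ _ (fOp_mem_strings h2)
  have hgen' : IsGenerator (eBar v) (n + 2) 0 0 := ⟨hv', hv'.pow_succ_eq_zero (hV.fNilpotent _),
    hc _, hχ _, eq_top_of_isSimpleModule
      (fun u x hx => smul_mem_strings hv' (hc _) (hχ _) h3 u hx) (self_mem_strings _) h1⟩
  exact hv0 (hgen'.eq_zero (by simpa using hv))

end Structure

/-! ### Self-extensions of a cyclic module -/

section ExtCyclic

open CategoryTheory Abelian

universe u

variable {k : Type} [Field k] {A : Type} [Ring A] [Algebra k A] (V : ModuleCat.{u} A) (v : V)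

/-- The annihilator of `v`. -/
def annihilator : Submodule A A := LinearMap.ker (LinearMap.toSpanSingleton A V v)

/-- The complex `Ann(v) → A → V`. -/
noncomputable def annihilatorComplex : ShortComplex (ModuleCat.{u} A) where
  X₁ := ModuleCat.of A (ULift.{u} (annihilator V v))
  X₂ := ModuleCat.of A (ULift.{u} A)
  X₃ := V
  f := ModuleCat.ofHom (ULift.moduleEquiv.symm.toLinearMap ∘ₗ (annihilator V v).subtype ∘ₗ
    ULift.moduleEquiv.toLinearMap)
  g := ModuleCat.ofHom (LinearMap.toSpanSingleton A V v ∘ₗ ULift.moduleEquiv.toLinearMap)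
  zero := by
    ext ⟨x, hx⟩
    exact hx

variable {v}

lemma annihilatorComplex_shortExact (hv : ∀ x : V, ∃ a : A, a • v = x) :
    (annihilatorComplex V v).ShortExact where
  exact := by
    rw [ShortComplex.moduleCat_exact_iff]
    rintro ⟨a⟩ ha
    exact ⟨⟨⟨a, ha⟩⟩, rfl⟩
  mono_f := (ModuleCat.mono_iff_injective _).mpr fun x y hxy => by
    have := congrArg ULift.down hxy
    exact ULift.ext _ _ (Subtype.ext this)
  epi_g := (ModuleCat.epi_iff_surjective _).mpr fun x => by
    obtain ⟨a, ha⟩ := hv x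
    exact ⟨⟨a⟩, ha⟩

lemma projective_annihilatorComplex : Projective (annihilatorComplex V v).X₂ := by
  have : Module.Projective A (ULift.{u} A) := Module.Projective.of_equiv ULift.moduleEquiv.symm
  exact (IsProjective.iff_projective (ULift.{u} A)).mp this

open ModuleCat in
/-- A criterion for the first self-extension space of a cyclic module `V = A v` to be
one-dimensional: it is detected by the value of homomorphisms `Ann(v) → V` at some `z ∈ Ann(v)`. -/
theorem ext_self_equiv (hv : ∀ x : V, ∃ a : A, a • v = x) (z : annihilator V v)
    (hz : ∀ x : V, (z : A) • x = 0)
    (h₁ : ∀ φ : annihilator V v →ₗ[A] V, ∃ r : k, φ z = algebraMap k A r • v)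
    (h₂ : ∃ φ : annihilator V v →ₗ[A] V, φ z ≠ 0)
    (h₃ : ∀ φ : annihilator V v →ₗ[A] V, φ z = 0 →
      ∃ m : V, ∀ a : annihilator V v, φ a = (a : A) • m) :
    Nonempty (Ext V V 1 ≃ₗ[k] k) := by
  have hS := annihilatorComplex_shortExact V hv
  have _ := projective_annihilatorComplex V (v := v)
  let Φ : ((annihilatorComplex V v).X₁ ⟶ V) →ₗ[k] Ext V V 1 :=
    (Ext.bilinearCompOfLinear k V (annihilatorComplex V v).X₁ V 1 0 1 rfl hS.extClass) ∘ₗ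
      (Ext.linearEquiv₀ (R := k)).symm.toLinearMap
  have hΦ (φ) : Φ φ = hS.extClass.comp (Ext.mk₀ φ) rfl := rfl
  -- The connecting map Hom(Ann(v), V) → Ext¹(V, V) is onto because A is projective; its kernel
  -- consists of the restrictions of maps A → V.
  have hsurj : Function.Surjective Φ := fun x => by
    obtain ⟨y, hy⟩ := Ext.contravariant_sequence_exact₃ hS V x (Ext.eq_zero_of_projective _)
      (n₀ := 0) rfl
    refine ⟨Ext.linearEquiv₀ (R := k) y, ?_⟩
    rw [hΦ, Ext.mk₀_linearEquiv₀_apply]; exact hy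
  -- evaluation at `z`
  let ev : ((annihilatorComplex V v).X₁ ⟶ V) → V := fun φ => φ.hom ⟨z⟩
  -- A restriction a ↦ a m takes z to z m = 0. The converse is the hypothesis `h₃`, so Ext¹(V, V) is
  -- identified with the values at z.
  have hker (φ) (h0 : Φ φ = 0) : ev φ = 0 := by
    obtain ⟨y, hy⟩ := Ext.contravariant_sequence_exact₁ hS V (Ext.mk₀ φ) rfl h0
    obtain ⟨ψ, rfl⟩ := (Ext.linearEquiv₀ (R := k)).symm.surjective y
    change (Ext.mk₀ _).comp (Ext.mk₀ ψ) _ = _ at hy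
    rw [Ext.mk₀_comp_mk₀] at hy
    have : (annihilatorComplex V v).f ≫ ψ = φ :=
      (Ext.linearEquiv₀ (R := k)).symm.injective hy
    rw [← this]
    change ψ.hom ⟨(z : A)⟩ = 0
    have h1 : (⟨(z : A)⟩ : ULift.{u} A) = (z : A) • (⟨1⟩ : ULift.{u} A) :=
      ULift.ext _ _ (mul_one _).symm
    have h2 := ψ.hom.map_smul (z : A) (⟨1⟩ : ULift.{u} A)
    rw [h1]
    exact h2.trans (hz _)
  have hker' (φ) (h0 : ev φ = 0) : Φ φ = 0 := by
    obtain ⟨m, hm⟩ := h₃ (φ.hom ∘ₗ ULift.moduleEquiv.symm.toLinearMap) h0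
    let ψ : (annihilatorComplex V v).X₂ ⟶ V :=
      ModuleCat.ofHom (LinearMap.toSpanSingleton A V m ∘ₗ ULift.moduleEquiv.toLinearMap)
    have : φ = (annihilatorComplex V v).f ≫ ψ := by
      ext ⟨a⟩
      exact hm a
    rw [hΦ, this, ← Ext.mk₀_comp_mk₀, ← Ext.comp_assoc_of_third_deg_zero, hS.extClass_comp,
      Ext.zero_comp]
    rfl
  obtain ⟨φ, hφ⟩ := h₂
  let φ₀ : (annihilatorComplex V v).X₁ ⟶ V :=
    ModuleCat.ofHom (φ ∘ₗ ULift.moduleEquiv.toLinearMap)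
  have hev (r : k) (ψ χ) : ev (ψ - r • χ) = ev ψ - algebraMap k A r • ev χ := rfl
  refine ⟨(LinearEquiv.ofBijective (LinearMap.toSpanSingleton k _ (Φ φ₀)) ⟨?_, ?_⟩).symm⟩
  · rw [← LinearMap.ker_eq_bot, LinearMap.ker_toSpanSingleton]
    exact fun h0 => hφ (hker φ₀ h0)
  · intro x
    obtain ⟨ψ, rfl⟩ := hsurj x
    obtain ⟨r₀, hr₀⟩ := h₁ φ
    obtain ⟨r, hr⟩ := h₁ (ψ.hom ∘ₗ ULift.moduleEquiv.symm.toLinearMap)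
    have hr₀' : r₀ ≠ 0 := fun h => hφ (by rw [hr₀, h, map_zero, zero_smul])
    refine ⟨r / r₀, ?_⟩
    have h0 := hker' (ψ - (r / r₀) • φ₀) (by
      rw [hev]
      change ψ.hom ⟨z⟩ - algebraMap k A (r / r₀) • φ z = 0
      have hr' : ψ.hom ⟨z⟩ = algebraMap k A r • v := hr
      rw [hr₀, hr', ← mul_smul, ← map_mul, div_mul_cancel₀ r hr₀', sub_self])
    rw [map_sub, map_smul, sub_eq_zero] at h0
    rw [LinearMap.toSpanSingleton_apply, h0]

end ExtCyclic

/-! ### From 𝔗-modules to U(𝔗)-modules -/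

section LieToU

variable (V : Type*) [AddCommGroup V] [Module ℂ V] [LieRingModule Takiff V] [LieModule ℂ Takiff V]

/-- The action of `U(𝔗)` on a `𝔗`-module. -/
@[reducible]
def uModule : Module U V :=
  Module.compHom V (UniversalEnvelopingAlgebra.lift ℂ (LieModule.toEnd ℂ Takiff V)).toRingHom

lemma uModule_smul (u : U) (x : V) : letI := uModule V
    u • x = UniversalEnvelopingAlgebra.lift ℂ (LieModule.toEnd ℂ Takiff V) u x := rfl

lemma uModule_iota_smul (t : Takiff) (x : V) : letI := uModule V
    (UniversalEnvelopingAlgebra.ι ℂ t : U) • x = ⁅t, x⁆ := by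
  rw [uModule_smul, UniversalEnvelopingAlgebra.lift_ι_apply]; rfl

lemma uModule_isScalarTower : letI := uModule V; IsScalarTower ℂ U V := by
  let _ := uModule V
  refine ⟨fun r u x => ?_⟩
  rw [uModule_smul, uModule_smul, map_smul]; rfl

end LieToU

/-! ### Harish-Chandra modules are spanned by strings -/

section HarishChandra

variable {V : Type*} [AddCommGroup V] [Module ℂ V] [Module U V] [IsScalarTower ℂ U V]

/-- As h has finitely many eigenvalues on S, some eigenvalue μ has μ + 2 not among them, so e kills
its eigenvector w. The vectors fᵏ w have distinct weights, so f is nilpotent on w and μ is a natural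
number. -/
lemma exists_isHighest_mem {S : Submodule ℂ V} [FiniteDimensional ℂ S] (hne : S ≠ ⊥)
    (he : ∀ x ∈ S, eOp x ∈ S) (hf : ∀ x ∈ S, fOp x ∈ S) (hh : ∀ x ∈ S, hOp x ∈ S) :
    ∃ w ∈ S, ∃ n : ℕ, w ≠ 0 ∧ IsHighest w n ∧ (fOp ^ (n + 1)) w = 0 := by
  have _ : Nontrivial S := Submodule.nontrivial_iff_ne_bot.mpr hne
  let A : Module.End ℂ S := hOp.restrict hh
  have hA (x : V) (hx : x ∈ S) (h0 : x ≠ 0) (μ : ℂ) (h : hOp x = μ • x) : A.HasEigenvalue μ :=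
    Module.End.hasEigenvalue_of_hasEigenvector (x := ⟨x, hx⟩)
      ⟨Module.End.mem_eigenspace_iff.mpr (Subtype.ext h), fun h => h0 (congrArg Subtype.val h)⟩
  have hfin : {μ | A.HasEigenvalue μ}.Finite := Module.End.finite_hasEigenvalue A
  have hex : ∃ μ, A.HasEigenvalue μ ∧ ¬ A.HasEigenvalue (μ + 2) := by
    by_contra! hcon
    obtain ⟨μ, hμ⟩ := Module.End.exists_eigenvalue A
    have (k : ℕ) : A.HasEigenvalue (μ + 2 * k) := by
      induction k with
      | zero => simpa using hμ
      | succ k ih => convert hcon _ ih using 1; push_cast; ring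
    exact Set.infinite_of_injective_forall_mem (f := fun k : ℕ => μ + 2 * k)
      (fun a b hab => by simpa using hab) this hfin
  obtain ⟨μ, h1, h2⟩ := hex
  obtain ⟨⟨w, hwS⟩, hw⟩ := h1.exists_hasEigenvector
  have hw0 : w ≠ 0 := fun h => hw.2 (Subtype.ext h)
  have hwμ : hOp w = μ • w := congrArg Subtype.val (Module.End.mem_eigenspace_iff.mp hw.1)
  have hw' : IsHighest w μ := ⟨by
    by_contra h0
    exact h2 (hA _ (he w hwS) h0 _ (by rw [h_e, hwμ, map_smul]; module)), hwμ⟩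
  have hmem (j : ℕ) : (fOp ^ j) w ∈ S := by
    induction j with
    | zero => exact hwS
    | succ j ih => rw [pow_succ', Module.End.mul_apply]; exact hf _ ih
  have hnil : ∃ p, (fOp ^ p) w = 0 := by
    by_contra! hcon
    exact Set.infinite_of_injective_forall_mem (f := fun k : ℕ => μ - 2 * k)
      (fun a b hab => by simpa using hab)
      (fun k => hA _ (hmem k) (hcon k) _ (hw'.h_pow k)) hfin
  have hμ : ∃ n : ℕ, μ = n := by
    by_contra! hcon
    exact hw0 (hw'.eq_zero hcon hnil)
  obtain ⟨n, rfl⟩ := hμ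
  exact ⟨w, hwS, n, hw0, hw', hw'.pow_succ_eq_zero hnil⟩

/-- The string of a highest weight vector is stable under e, f and h, so minimality of S makes it
all of S. -/
lemma le_span_isStringVector {S : Submodule ℂ V} [FiniteDimensional ℂ S] (hne : S ≠ ⊥)
    (he : ∀ x ∈ S, eOp x ∈ S) (hf : ∀ x ∈ S, fOp x ∈ S) (hh : ∀ x ∈ S, hOp x ∈ S)
    (hS : ∀ T ≤ S, T ≠ ⊥ → (∀ x ∈ T, eOp x ∈ T) → (∀ x ∈ T, fOp x ∈ T) → (∀ x ∈ T, hOp x ∈ T) →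
      T = S) :
    S ≤ Submodule.span ℂ {x | IsStringVector x} := by
  obtain ⟨w, hwS, n, hw0, hw, hn⟩ := exists_isHighest_mem hne he hf hh
  let T : Submodule ℂ V := Submodule.span ℂ (Set.range fun j : ℕ => (fOp ^ j) w)
  have hT (j : ℕ) : (fOp ^ j) w ∈ T := Submodule.subset_span ⟨j, rfl⟩
  have hstable (g : V →ₗ[ℂ] V) (hg : ∀ j, g ((fOp ^ j) w) ∈ T) : ∀ x ∈ T, g x ∈ T := by
    intro x hx
    refine (Submodule.span_le (p := T.comap g)).mpr ?_ hx
    rintro _ ⟨j, rfl⟩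
    exact hg j
  have hTS : T = S := by
    refine hS T (Submodule.span_le.mpr ?_) (fun h0 => hw0 ?_) (hstable _ fun j => ?_)
      (hstable _ fun j => ?_) (hstable _ fun j => ?_)
    · rintro _ ⟨j, rfl⟩
      induction j with
      | zero => exact hwS
      | succ j ih =>
        change (fOp ^ (j + 1)) w ∈ S
        rw [pow_succ', Module.End.mul_apply]; exact hf _ ih
    · have := hT 0
      rwa [h0, Submodule.mem_bot] at this
    · rcases j with _ | j
      · simp [hw.e]
      · rw [hw.e_pow]; exact T.smul_mem _ (hT j)
    · rw [← Module.End.mul_apply, ← pow_succ']; exact hT _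
    · rw [hw.h_pow]; exact T.smul_mem _ (hT j)
  rw [← hTS]
  refine Submodule.span_le.mpr ?_
  rintro _ ⟨j, rfl⟩
  by_cases hj : j ≤ n
  · exact Submodule.subset_span ⟨w, n, j, hw, hn, hj, rfl⟩
  · have : (fOp ^ j) w = 0 := pow_eq_zero_of_le (by omega) hn
    change (fOp ^ j) w ∈ _
    rw [this]; exact zero_mem _

variable [LieRingModule Takiff V] [LieModule ℂ Takiff V]

lemma IsHarishChandra.isStringSpanned
    (hcomp : ∀ (t : Takiff) (x : V), (UniversalEnvelopingAlgebra.ι ℂ t : U) • x = ⁅t, x⁆)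
    (hV : IsHarishChandra V) : IsStringSpanned V := by
  obtain ⟨𝒮, -, htop, hirr, -⟩ := hV
  have hmem (a : Sl2) : incl a ∈ gSub := ⟨a, rfl⟩
  have hstab (S : LieSubmodule ℂ gSub V) (a : Sl2) (x : V) (hx : x ∈ S) : uIncl a • x ∈ S := by
    rw [uIncl, hcomp]
    exact S.lie_mem (x := ⟨incl a, hmem a⟩) hx
  refine top_unique ?_
  rw [← LieSubmodule.top_toSubmodule (R := ℂ) (L := gSub) (M := V), ← htop,
    LieSubmodule.sSup_toSubmodule]
  refine sSup_le ?_
  rintro _ ⟨S, hS, rfl⟩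
  obtain ⟨h1, h2⟩ := hirr S hS
  have _ : FiniteDimensional ℂ S.toSubmodule := h2
  refine le_span_isStringVector (fun h0 => ?_) (hstab S e) (hstab S f) (hstab S h) ?_
  · have _ : Nontrivial S := LieModule.nontrivial_of_isIrreducible ℂ gSub S
    obtain ⟨x, hx⟩ := exists_ne (0 : S)
    have : (x : V) ∈ S.toSubmodule := x.2
    rw [h0, Submodule.mem_bot] at this
    exact hx (Subtype.ext this)
  · intro T hTS hT he hf hh
    have hTstab (a : Sl2) (x : V) (hx : x ∈ T) : uIncl a • x ∈ T := by
      obtain ⟨r, s, t, rfl⟩ := sl2_decomp a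
      simp only [uIncl_add, uIncl_smul, add_smul, smul_assoc]
      exact add_mem (add_mem (T.smul_mem _ (hf x hx)) (T.smul_mem _ (hh x hx)))
        (T.smul_mem _ (he x hx))
    let T' : LieSubmodule ℂ gSub S :=
      { T.comap S.toSubmodule.subtype with
        lie_mem := by
          rintro ⟨_, a, rfl⟩ m hm
          have := hTstab a m hm
          rw [uIncl, hcomp] at this
          exact this }
    have hT' : T' = ⊤ := (eq_bot_or_eq_top T').resolve_left fun h0 => hT <| by
      refine (Submodule.eq_bot_iff T).mpr fun x hx => ?_
      have : (⟨x, hTS hx⟩ : S) ∈ T' := hx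
      rw [h0, LieSubmodule.mem_bot] at this
      exact congrArg Subtype.val this
    refine le_antisymm hTS fun x hx => ?_
    have : (⟨x, hx⟩ : S) ∈ T' := hT' ▸ LieSubmodule.mem_top _
    exact this

omit [LieModule ℂ Takiff V] in
lemma isSimpleModule_of_isIrreducible
    (hcomp : ∀ (t : Takiff) (x : V), (UniversalEnvelopingAlgebra.ι ℂ t : U) • x = ⁅t, x⁆)
    (hV : LieModule.IsIrreducible ℂ Takiff V) : IsSimpleModule U V := by
  have _ : Nontrivial V := LieModule.nontrivial_of_isIrreducible ℂ Takiff V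
  refine { toIsSimpleOrder := { eq_bot_or_eq_top := fun S => ?_ } }
  let S' : LieSubmodule ℂ Takiff V :=
    { S.restrictScalars ℂ with
      lie_mem := fun {t m} hm => by rw [← hcomp]; exact S.smul_mem _ hm }
  rcases eq_bot_or_eq_top S' with h | h
  · left
    refine (Submodule.eq_bot_iff S).mpr fun x hx => ?_
    have : x ∈ S' := hx
    rwa [h, LieSubmodule.mem_bot] at this
  · right
    refine eq_top_iff.mpr fun x _ => ?_
    have : x ∈ S' := h ▸ LieSubmodule.mem_top _
    exact this

end HarishChandra

/-! ### Schur's lemma by counting dimensions -/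

section Schur

variable {V : Type*} [AddCommGroup V] [Module ℂ V]

open Polynomial in
/-- The resolvent of an operator with empty spectrum, applied to a nonzero vector, gives a linearly
independent family. -/
lemma linearIndependent_resolvent {A : Module.End ℂ V} {B : ℂ → Module.End ℂ V}
    (hB : ∀ r, (A - algebraMap ℂ _ r) * B r = 1) (hA : ∀ r, IsUnit (A - algebraMap ℂ _ r))
    {v : V} (hv : v ≠ 0) : LinearIndependent ℂ fun r => B r v := by
  classical
  refine linearIndependent_iff'.mpr fun s g hg r hr => ?_
  -- Clearing denominators in Σ gᵢ (A - i)⁻¹ v = 0 gives q(A) v = 0. A nonzero q splits over ℂ, so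
  -- q(A) would be invertible; hence q = 0, and evaluating at r isolates g r.
  let q : ℂ[X] := ∑ i ∈ s, C (g i) * ∏ j ∈ s.erase i, (X - C j)
  have h1 : aeval A q v = 0 := by
    have hP : aeval A (∏ j ∈ s, (X - C j)) (∑ i ∈ s, g i • B i v) = 0 := by rw [hg, map_zero]
    rw [map_sum] at hP
    rw [map_sum, LinearMap.sum_apply, ← hP]
    refine Finset.sum_congr rfl fun i hi => ?_
    rw [← Finset.prod_erase_mul s _ hi, map_mul, map_mul, map_smul, Module.End.mul_apply]
    have h2 : aeval A (X - C i) (B i v) = v := by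
      rw [map_sub, aeval_X, aeval_C, ← Module.End.mul_apply, hB, Module.End.one_apply]
    rw [Module.End.mul_apply _ (aeval A (X - C i)), h2, aeval_C, Module.algebraMap_end_apply]
  have h2 : q = 0 := by
    by_contra hq
    have h3 : IsUnit (aeval A q) := by
      have hs := (IsAlgClosed.splits q).eq_prod_roots
      rw [hs, map_mul, aeval_C]
      refine IsUnit.mul ((IsUnit.mk0 _ (leadingCoeff_ne_zero.mpr hq)).map (algebraMap ℂ _)) ?_
      induction q.roots using Multiset.induction with
      | empty => simp
      | cons a t ih =>
        rw [Multiset.map_cons, Multiset.prod_cons, map_mul, map_sub, aeval_X, aeval_C]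
        exact (hA a).mul ih
    obtain ⟨u, hu⟩ := h3
    apply hv
    have := congrArg (↑u⁻¹ : Module.End ℂ V) h1
    rwa [← hu, ← Module.End.mul_apply, Units.inv_mul, map_zero, Module.End.one_apply] at this
  have h3 : q.eval r = g r * ∏ j ∈ s.erase r, (r - j) := by
    rw [eval_finsetSum, Finset.sum_eq_single r]
    · simp [eval_prod]
    · intro i hi hir
      rw [eval_mul, eval_prod, Finset.prod_eq_zero (i := r) (Finset.mem_erase.mpr ⟨hir.symm, hr⟩),
        mul_zero]
      simp
    · exact fun h => absurd hr h
  rw [h2, eval_zero] at h3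
  refine (mul_eq_zero.mp h3.symm).resolve_right (Finset.prod_ne_zero_iff.mpr fun j hj => ?_)
  exact sub_ne_zero.mpr (Finset.ne_of_mem_erase hj).symm

variable [Module U V] [IsScalarTower ℂ U V]

/-- V is spanned by the countably many words in e, f, ē applied to one nonzero vector. -/
lemma rank_le_aleph0 [IsSimpleModule U V] : Module.rank ℂ V ≤ Cardinal.aleph0 := by
  have _ := IsSimpleModule.nontrivial U V
  obtain ⟨v, hv⟩ := exists_ne (0 : V)
  let op : Fin 3 → V →ₗ[ℂ] V := ![eOp, fOp, eBar]
  let b : List (Fin 3) → V := fun l => l.foldr (fun i x => op i x) v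
  let S := Submodule.span ℂ (Set.range b)
  have hstab (i : Fin 3) : ∀ x ∈ S, op i x ∈ S := fun x hx => by
    refine (Submodule.span_le (p := S.comap (op i))).mpr ?_ hx
    rintro _ ⟨l, rfl⟩
    exact Submodule.subset_span ⟨i :: l, rfl⟩
  have hS : S = ⊤ := eq_top_of_isSimpleModule
    (fun u x hx => smul_mem_of_generators S (hstab 0) (hstab 1) (hstab 2) u hx)
    (Submodule.subset_span ⟨[], rfl⟩ : v ∈ S) hv
  rw [← rank_top ℂ V, ← hS]
  refine (rank_span_le _).trans ?_
  exact (Set.countable_range b).le_aleph0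

/-- Schur's lemma for simple `U(𝔗)`-modules. -/
theorem exists_eq_smul [IsSimpleModule U V] (φ : V →ₗ[U] V) : ∃ r : ℂ, ∀ x, φ x = r • x := by
  by_contra! hcon
  have _ := IsSimpleModule.nontrivial U V
  obtain ⟨v, hv⟩ := exists_ne (0 : V)
  let A : Module.End ℂ V := φ.restrictScalars ℂ
  have hA (r : ℂ) : IsUnit (A - algebraMap ℂ _ r) := by
    have h1 : φ - r • LinearMap.id ≠ 0 := fun h0 => by
      obtain ⟨x, hx⟩ := hcon r
      have := LinearMap.congr_fun h0 x
      rw [LinearMap.sub_apply, LinearMap.zero_apply, sub_eq_zero] at this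
      exact hx this
    rw [Module.End.isUnit_iff]
    exact LinearMap.bijective_of_ne_zero (f := φ - r • LinearMap.id) h1
  choose B hB using fun r => (hA r).exists_right_inv
  -- If φ were not a scalar, its resolvents would give an independent family indexed by ℂ in a space
  -- of countable dimension.
  have h1 := (linearIndependent_resolvent hB hA hv).cardinal_lift_le_rank
  rw [Cardinal.mk_complex] at h1
  have h2 := Cardinal.lift_le.mpr (rank_le_aleph0 (V := V))
  rw [Cardinal.lift_aleph0] at h2
  have h3 := h1.trans h2
  rw [Cardinal.lift_continuum] at h3
  exact absurd h3 (not_le.mpr Cardinal.aleph0_lt_continuum)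

end Schur

/-! ### The self-extension given by rescaling 𝔤̄ -/

section Euler

variable (V : Type*) [AddCommGroup V] [Module ℂ V] [Module U V] [IsScalarTower ℂ U V]

/-- The self-extension `V[ε]` of `V` on which `v̄ ∈ 𝔤̄` acts by `(1 + ε) v̄`. -/
def EulerExt : Type _ := V × V

instance : AddCommGroup (EulerExt V) := inferInstanceAs (AddCommGroup (V × V))
instance : Module ℂ (EulerExt V) := inferInstanceAs (Module ℂ (V × V))

variable {V} in
/-- The element `x + ε y` of `V[ε]`. -/
def eulerMk (x y : V) : EulerExt V := (x, y)

instance : LieRingModule Takiff (EulerExt V) where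
  bracket t m := eulerMk ((UniversalEnvelopingAlgebra.ι ℂ t : U) • m.1)
    ((UniversalEnvelopingAlgebra.ι ℂ t : U) • m.2 + uBar (odd t) • m.1)
  add_lie s t m := by
    refine Prod.ext ?_ ?_
    · exact (congrArg (· • m.1) (map_add _ s t)).trans (add_smul _ _ _)
    · change (_ : U) • m.2 + _ = (_ • m.2 + _) + (_ • m.2 + _)
      rw [map_add, map_add, uBar_add, add_smul, add_smul]; abel
  lie_add t m m' := by
    refine Prod.ext (smul_add _ _ _) ?_
    change _ • (m.2 + m'.2) + _ • (m.1 + m'.1) = (_ • m.2 + _) + (_ • m'.2 + _)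
    rw [smul_add, smul_add]; abel
  leibniz_lie s t m := by
    refine Prod.ext ?_ ?_
    · change _ • _ • m.1 = UniversalEnvelopingAlgebra.ι ℂ ⁅s, t⁆ • m.1 + _ • _ • m.1
      rw [iota_lie, sub_smul, mul_smul, mul_smul, sub_add_cancel]
    · change _ • (_ • m.2 + _ • m.1) + uBar (odd s) • _ • m.1 =
        (UniversalEnvelopingAlgebra.ι ℂ ⁅s, t⁆ • m.2 + uBar (odd ⁅s, t⁆) • m.1) +
          (_ • (_ • m.2 + _ • m.1) + uBar (odd t) • _ • m.1)
      have hs : (UniversalEnvelopingAlgebra.ι ℂ s : U) = uIncl (even s) + uBar (odd s) := by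
        conv_lhs => rw [takiff_decomp s, map_add]
        rfl
      have ht : (UniversalEnvelopingAlgebra.ι ℂ t : U) = uIncl (even t) + uBar (odd t) := by
        conv_lhs => rw [takiff_decomp t, map_add]
        rfl
      rw [iota_lie, odd_lie, uBar_add, uBar_lie, uBar_lie', hs, ht]
      have h3 := uBar_swap (M := V) (odd s) (odd t) m.1
      simp only [add_smul, sub_smul, mul_smul, smul_add, h3]
      abel

instance : LieModule ℂ Takiff (EulerExt V) where
  smul_lie r t m := by
    refine Prod.ext ?_ ?_
    · change UniversalEnvelopingAlgebra.ι ℂ (r • t) • m.1 = r • _ • m.1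
      rw [map_smul, smul_assoc]
    · change UniversalEnvelopingAlgebra.ι ℂ (r • t) • m.2 + uBar (odd (r • t)) • m.1 =
        r • (_ • m.2 + _ • m.1)
      rw [map_smul, map_smul, uBar_smul, smul_assoc, smul_assoc, smul_add]
  lie_smul r t m := by
    refine Prod.ext (smul_comm _ _ _) ?_
    change _ • r • m.2 + _ • r • m.1 = r • (_ • m.2 + _ • m.1)
    rw [smul_comm, smul_comm (uBar (odd t)), smul_add]

instance : Module U (EulerExt V) := uModule _
instance : IsScalarTower ℂ U (EulerExt V) := uModule_isScalarTower _

variable {V}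

omit [Module ℂ V] [Module U V] [IsScalarTower ℂ U V] in
lemma eulerMk_add (x y x' y' : V) : eulerMk x y + eulerMk x' y' = eulerMk (x + x') (y + y') := rfl

lemma iota_smul_eulerMk (t : Takiff) (x y : V) :
    (UniversalEnvelopingAlgebra.ι ℂ t : U) • eulerMk x y =
      eulerMk ((UniversalEnvelopingAlgebra.ι ℂ t : U) • x)
        ((UniversalEnvelopingAlgebra.ι ℂ t : U) • y + uBar (odd t) • x) :=
  uModule_iota_smul _ _ _

lemma uBar_smul_eulerMk (a : Sl2) (x y : V) :
    uBar a • eulerMk x y = eulerMk (uBar a • x) (uBar a • (y + x)) := by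
  have h1 : odd (bar a) = a := by
    change odd (tens _ a) = a
    rw [odd_tens]; simp
  rw [uBar, iota_smul_eulerMk, h1, smul_add]; rfl

lemma smul_eulerMk_fst (u : U) (x y : V) : (u • eulerMk x y).1 = u • x := by
  induction u using U_induction generalizing x y with
  | algebraMap r =>
    rw [algebraMap_smul, algebraMap_smul]; rfl
  | iota t => rw [iota_smul_eulerMk]; rfl
  | mul a b ha hb =>
    have : b • eulerMk x y = eulerMk (b • x) (b • eulerMk x y).2 := Prod.ext (hb x y) rfl
    rw [mul_smul, mul_smul, this, ha]
  | add a b ha hb =>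
    rw [add_smul, add_smul, ← ha x y, ← hb x y]; rfl

lemma smul_eulerMk_zero (u : U) (y : V) : u • eulerMk 0 y = eulerMk 0 (u • y) := by
  induction u using U_induction generalizing y with
  | algebraMap r =>
    rw [algebraMap_smul, algebraMap_smul]
    exact Prod.ext (smul_zero _) rfl
  | iota t => rw [iota_smul_eulerMk, smul_zero, smul_zero, add_zero]
  | mul a b ha hb => rw [mul_smul, mul_smul, hb, ha]
  | add a b ha hb => rw [add_smul, add_smul, ha, hb, eulerMk_add, add_zero]

/-- C̄ is quadratic in 𝔤̄, and (1 + ε)² = 1 + 2ε. -/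
lemma Cbar_smul_eulerMk (x : V) :
    Cbar • eulerMk x 0 = eulerMk (Cbar • x) ((2 : ℂ) • Cbar • x) := by
  rw [← cBar_def, cBar_apply, ← cBar_def, cBar_apply]
  simp only [hBar_def, fBar_def, eBar_def, uBar_smul_eulerMk]
  refine Prod.ext rfl ?_
  change uBar h • (_ • (0 + x) + uBar h • x) + (4 : ℂ) • (uBar f • (_ • (0 + x) + uBar e • x)) =
    (2 : ℂ) • (uBar h • uBar h • x + (4 : ℂ) • (uBar f • uBar e • x))
  rw [zero_add, smul_add, smul_add]
  generalize uBar h • uBar h • x = y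
  generalize uBar f • uBar e • x = z
  module

end Euler

/-! ### One-dimensionality of the self-extension space -/

section SelfExt

universe u

variable {V : Type u} [AddCommGroup V] [Module ℂ V] [Module U V] [IsScalarTower ℂ U V]
  {v : V}

/-- The derivative of the action of the annihilator of `v` along the Euler derivation of `𝔗`. -/
def eulerHom (v : V) : annihilator (ModuleCat.of U V) v →ₗ[U] V where
  toFun k := ((k : U) • eulerMk v 0).2
  map_add' a b := congrArg Prod.snd (add_smul (a : U) (b : U) (eulerMk v 0))
  map_smul' a b := by
    have h1 : (b : U) • eulerMk v 0 = eulerMk 0 ((b : U) • eulerMk v 0).2 :=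
      Prod.ext ((smul_eulerMk_fst _ _ _).trans b.2) rfl
    change ((a * b : U) • eulerMk v 0).2 = a • ((b : U) • eulerMk v 0).2
    rw [mul_smul, h1, smul_eulerMk_zero]; rfl

variable (φ : annihilator (ModuleCat.of U V) v →ₗ[U] V)

/-- The submodule of `V × U(𝔗)` by which one divides to get the pushout of `Ann(v) → U(𝔗)`
along `φ`. -/
def pushoutRel : Submodule U (V × U) :=
  LinearMap.range (LinearMap.prod (-φ) (annihilator (ModuleCat.of U V) v).subtype)

/-- The pushout of `Ann(v) → U(𝔗)` along `φ : Ann(v) → V`, an extension of `U(𝔗) v` by `V`. -/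
abbrev Pushout : Type u := (V × U) ⧸ pushoutRel φ

/-- The inclusion of `V` into the pushout. -/
def pushoutInl : V →ₗ[U] Pushout φ := (pushoutRel φ).mkQ ∘ₗ LinearMap.inl U V U

/-- The canonical generator of the pushout modulo `V`. -/
def pushoutOne : Pushout φ := (pushoutRel φ).mkQ (0, 1)

/-- The projection of the pushout to `V`. -/
def pushoutProj : Pushout φ →ₗ[U] V :=
  (pushoutRel φ).liftQ (LinearMap.toSpanSingleton U V v ∘ₗ LinearMap.snd U V U) (by
    rintro _ ⟨k, rfl⟩
    exact k.2)

omit [Module ℂ V] [IsScalarTower ℂ U V] in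
lemma pushoutProj_one : pushoutProj φ (pushoutOne φ) = v := one_smul U v

omit [Module ℂ V] [IsScalarTower ℂ U V] in
lemma pushoutInl_injective : Function.Injective (pushoutInl φ) := by
  refine (injective_iff_map_eq_zero _).mpr fun x hx => ?_
  obtain ⟨k, hk⟩ := (Submodule.Quotient.mk_eq_zero _).mp hx
  have h1 : (k : U) = 0 := congrArg Prod.snd hk
  have h2 : -φ k = x := congrArg Prod.fst hk
  have h3 : k = 0 := Subtype.ext h1
  rw [← h2, h3, map_zero, neg_zero]

omit [Module ℂ V] [IsScalarTower ℂ U V] in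
lemma smul_pushoutOne (u : U) : u • pushoutOne φ = (pushoutRel φ).mkQ (0, u) := by
  rw [pushoutOne, ← map_smul]
  congr 1
  exact Prod.ext (smul_zero u) (mul_one u)

omit [Module ℂ V] [IsScalarTower ℂ U V] in
lemma annihilator_smul_pushoutOne (k : annihilator (ModuleCat.of U V) v) :
    (k : U) • pushoutOne φ = pushoutInl φ (φ k) := by
  rw [smul_pushoutOne]
  refine (Submodule.Quotient.eq _).mpr ⟨k, ?_⟩
  refine Prod.ext ?_ ?_
  · exact (zero_sub _).symm
  · exact (sub_zero _).symm

omit [Module ℂ V] [IsScalarTower ℂ U V] in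
lemma pushout_exact : Function.Exact (pushoutInl φ) (pushoutProj φ) := by
  intro x
  constructor
  · intro hx
    obtain ⟨⟨y, u⟩, rfl⟩ := (pushoutRel φ).mkQ_surjective x
    have hu : u • v = 0 := hx
    refine ⟨y + φ ⟨u, hu⟩, ?_⟩
    rw [map_add, ← annihilator_smul_pushoutOne, smul_pushoutOne, pushoutInl, LinearMap.comp_apply,
      ← map_add]
    congr 1
    exact Prod.ext (add_zero _) (zero_add _)
  · rintro ⟨y, rfl⟩
    exact zero_smul U v

open CategoryTheory Abelian in
/-- The first self-extension space of the modules of the structure theorem is one-dimensional. -/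
theorem ext_self_of_isGenerator [IsSimpleModule U V] {n : ℕ} {c χ : ℂ}
    (hv : IsGenerator v n c χ) (hne : ∀ k : ℕ, (eBar ^ k) v ≠ 0) (hχ : χ ≠ 0)
    (hscal : ∀ x : V, cBar x = χ • x) :
    Nonempty (Ext (ModuleCat.of U V) (ModuleCat.of U V) 1 ≃ₗ[ℂ] ℂ) := by
  have h0 : v ≠ 0 := hne 0
  have hz (x : V) : (Cbar - algebraMap ℂ U χ) • x = 0 := by
    rw [sub_smul, algebraMap_smul, ← hscal]; exact sub_self _
  have hzc (a : Sl2) : uIncl a * (Cbar - algebraMap ℂ U χ) = (Cbar - algebraMap ℂ U χ) * uIncl a := by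
    rw [mul_sub, sub_mul, Cbar_comm, Algebra.commutes]
  have hcyc (x : V) : ∃ a : U, a • v = x := by
    have h1 : Submodule.span U {v} = ⊤ := (eq_bot_or_eq_top _).resolve_left fun h => h0 (by
      rwa [Submodule.span_singleton_eq_bot] at h)
    exact Submodule.mem_span_singleton.mp (h1 ▸ Submodule.mem_top)
  let z : annihilator (ModuleCat.of U V) v := ⟨_, hz v⟩
  let ke : annihilator (ModuleCat.of U V) v := ⟨uIncl e, hv.highest.e⟩
  let kh : annihilator (ModuleCat.of U V) v := ⟨uIncl h - algebraMap ℂ U n, by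
    change (uIncl h - algebraMap ℂ U n) • v = 0
    rw [sub_smul, algebraMap_smul, ← hv.highest.h]; exact sub_self _⟩
  refine ext_self_equiv (ModuleCat.of U V) hcyc z hz (fun φ => ?_) ?_ (fun φ hφ => ?_)
  -- As z is central, a φ(z) = φ(a z) = φ(z a) = z φ(a) = 0 for a in Ann(v), in particular for e and
  -- h - n.
  · have h1 : IsHighest (φ z) n := by
      constructor
      · have : uIncl e • z = (Cbar - algebraMap ℂ U χ) • ke := Subtype.ext (hzc e)
        rw [eOp_def, ← map_smul, this, map_smul, hz]
      · have : (uIncl h - algebraMap ℂ U n) • z = (Cbar - algebraMap ℂ U χ) • kh := Subtype.ext (by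
          change (uIncl h - algebraMap ℂ U n) * (Cbar - algebraMap ℂ U χ) =
            (Cbar - algebraMap ℂ U χ) * (uIncl h - algebraMap ℂ U n)
          rw [sub_mul, hzc, mul_sub (Cbar - algebraMap ℂ U χ), Algebra.commutes])
        have h2 : (uIncl h - algebraMap ℂ U n) • φ z = 0 := by
          rw [← map_smul, this, map_smul, hz]
        rw [sub_smul, algebraMap_smul, sub_eq_zero] at h2
        exact h2
    obtain ⟨a, ha⟩ := hv.eq_smul h1
    exact ⟨a, ha.trans (algebraMap_smul U a v).symm⟩
  · refine ⟨eulerHom v, ?_⟩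
    change ((Cbar - algebraMap ℂ U χ) • eulerMk v 0).2 ≠ 0
    have : ((Cbar - algebraMap ℂ U χ) • eulerMk v 0) =
        eulerMk (Cbar • v - χ • v) ((2 : ℂ) • Cbar • v) := by
      rw [sub_smul, algebraMap_smul, Cbar_smul_eulerMk]
      exact Prod.ext rfl ((congrArg (_ - ·) (smul_zero χ)).trans (sub_zero _))
    rw [this]
    change (2 : ℂ) • Cbar • v ≠ 0
    rw [← cBar_def, hscal]
    exact smul_ne_zero two_ne_zero (smul_ne_zero hχ h0)
  -- In the pushout along φ, each k in Ann(v) sends the generator to φ(k). A corrected lift, the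
  -- generator minus x, that Ann(v) kills therefore shows φ(a) = a x.
  · have hone (k : annihilator (ModuleCat.of U V) v) := annihilator_smul_pushoutOne φ k
    obtain ⟨x, hx, hfx⟩ := exists_highest_lift hv.isStringSpanned
      (FNilpotent.extension (pushout_exact φ) hv.fNilpotent hv.fNilpotent) (pushoutInl φ)
      (pushoutInl_injective φ) (n := n) (m := pushoutOne φ) ⟨_, hone ke⟩ ⟨φ kh, by
        have := hone kh
        change (uIncl h - algebraMap ℂ U n) • pushoutOne φ = _ at this
        rwa [sub_smul, algebraMap_smul] at this⟩
    have hproj : pushoutProj φ (pushoutOne φ - pushoutInl φ x) = v := by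
      rw [map_sub, pushoutProj_one, (pushout_exact φ).apply_apply_eq_zero, sub_zero]
    -- This is where φ(z) = 0 enters.
    have hC : cBar (pushoutOne φ - pushoutInl φ x) = χ • (pushoutOne φ - pushoutInl φ x) := by
      have h1 : (Cbar - algebraMap ℂ U χ) • (pushoutOne φ - pushoutInl φ x) = 0 := by
        rw [smul_sub, ← map_smul, hz, map_zero, sub_zero]
        exact (hone z).trans (by rw [hφ, map_zero])
      rw [sub_smul, algebraMap_smul, sub_eq_zero] at h1
      exact h1
    refine ⟨x, fun a => ?_⟩
    have := hv.smul_eq_zero_of_lift hne hχ (pushoutInl_injective φ) (pushout_exact φ) hx hfx hproj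
      hC (u := (a : U)) a.2
    rw [smul_sub, sub_eq_zero, hone, ← map_smul] at this
    exact pushoutInl_injective φ this

end SelfExt

open CategoryTheory Abelian in
theorem ext_self_of_isHarishChandra (V : Type*) [AddCommGroup V] [Module ℂ V]
    [LieRingModule Takiff V] [LieModule ℂ Takiff V] (hV : IsHarishChandra V)
    (hirr : LieModule.IsIrreducible ℂ Takiff V) (hinf : ¬ FiniteDimensional ℂ V) :
    Nonempty (Ext (toModuleCat V) (toModuleCat V) 1 ≃ₗ[ℂ] ℂ) := by
  let _ := uModule V
  have _ := uModule_isScalarTower V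
  have _ := isSimpleModule_of_isIrreducible (uModule_iota_smul V) hirr
  -- A commutes with U(𝔗) once its graph in V × V is stable under the generators e, f, ē.
  have hcentral (A : V →ₗ[ℂ] V) (he : ∀ x, A (eOp x) = eOp (A x)) (hf : ∀ x, A (fOp x) = fOp (A x))
      (hb : ∀ x, A (eBar x) = eBar (A x)) : ∃ r : ℂ, ∀ x, A x = r • x := by
    have hA (u : U) (x : V) : A (u • x) = u • A x := by
      have h1 := smul_mem_of_generators (M := V × V) (LinearMap.graph A)
        (fun m hm => by rw [LinearMap.mem_graph_iff] at hm ⊢; exact (congrArg eOp hm).trans (he _).symm)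
        (fun m hm => by rw [LinearMap.mem_graph_iff] at hm ⊢; exact (congrArg fOp hm).trans (hf _).symm)
        (fun m hm => by rw [LinearMap.mem_graph_iff] at hm ⊢; exact (congrArg eBar hm).trans (hb _).symm)
        u (m := (x, A x)) (by rw [LinearMap.mem_graph_iff])
      rw [LinearMap.mem_graph_iff] at h1
      exact h1.symm
    exact exists_eq_smul { toFun := A, map_add' := A.map_add, map_smul' := hA }
  obtain ⟨c, hc⟩ := hcentral cMix cMix_e cMix_f cMix_eBar
  obtain ⟨χ, hχ⟩ := hcentral cBar cBar_e cBar_f cBar_eBar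
  obtain ⟨v, n, hv, hne, hχ0⟩ :=
    exists_isGenerator (hV.isStringSpanned (uModule_iota_smul V)) hinf hc hχ
  exact ext_self_of_isGenerator hv hne hχ0 hχ

/-! ### `U(𝔤̄)` is a polynomial ring -/

section Polynomial

open MvPolynomial

/-- The coordinates of an element of `𝔰𝔩₂` with respect to `f, h, e`. -/
def coord : Sl2 →ₗ[ℂ] Fin 3 → ℂ where
  toFun a := ![a.1 1 0, a.1 0 0, a.1 0 1]
  map_add' a b := by
    ext i; fin_cases i <;> rfl
  map_smul' r a := by
    ext i; fin_cases i <;> rfl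

/-- The standard basis `f, h, e`. -/
def stdBasis : Fin 3 → Sl2 := ![f, h, e]

lemma coord_stdBasis (i : Fin 3) : coord (stdBasis i) = Pi.single i 1 := by
  have hm : coord (stdBasis i) = ![((![Matrix.single 1 0 1, Matrix.single 0 0 1 - Matrix.single 1 1 1,
      Matrix.single 0 1 1] : Fin 3 → Matrix (Fin 2) (Fin 2) ℂ) i) 1 0,
      ((![Matrix.single 1 0 1, Matrix.single 0 0 1 - Matrix.single 1 1 1,
      Matrix.single 0 1 1] : Fin 3 → Matrix (Fin 2) (Fin 2) ℂ) i) 0 0,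
      ((![Matrix.single 1 0 1, Matrix.single 0 0 1 - Matrix.single 1 1 1,
      Matrix.single 0 1 1] : Fin 3 → Matrix (Fin 2) (Fin 2) ℂ) i) 0 1] := by
    fin_cases i <;> rfl
  rw [hm]
  ext j
  fin_cases i <;> fin_cases j <;> simp

/-- The linear form attached to an element of `𝔰𝔩₂`. -/
def linearForm : Sl2 →ₗ[ℂ] MvPolynomial (Fin 3) ℂ :=
  (Fintype.linearCombination ℂ (X : Fin 3 → MvPolynomial (Fin 3) ℂ)) ∘ₗ coord

lemma linearForm_stdBasis (i : Fin 3) : linearForm (stdBasis i) = X i := by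
  rw [linearForm, LinearMap.comp_apply, coord_stdBasis, Fintype.linearCombination_apply_single,
    one_smul]

lemma linearMap_ext_stdBasis {W : Type*} [AddCommGroup W] [Module ℂ W] {g g' : Sl2 →ₗ[ℂ] W}
    (hg : ∀ i, g (stdBasis i) = g' (stdBasis i)) (a : Sl2) : g a = g' a := by
  obtain ⟨x, y, z, rfl⟩ := sl2_decomp a
  have h0 : g f = g' f := hg 0
  have h1 : g h = g' h := hg 1
  have h2 : g e = g' e := hg 2
  simp only [map_add, map_smul, h0, h1, h2]

/-- The adjoint action of `𝔤` on polynomials. -/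
def adDer (a : Sl2) : Derivation ℂ (MvPolynomial (Fin 3) ℂ) (MvPolynomial (Fin 3) ℂ) :=
  mkDerivation ℂ fun i => linearForm ⁅a, stdBasis i⁆

lemma adDer_linearForm (a b : Sl2) : adDer a (linearForm b) = linearForm ⁅a, b⁆ :=
  linearMap_ext_stdBasis (g := (adDer a).toLinearMap ∘ₗ linearForm)
    (g' := linearForm ∘ₗ (LieAlgebra.ad ℂ Sl2 a)) (fun i => by
      change adDer a (linearForm (stdBasis i)) = linearForm ⁅a, stdBasis i⁆
      rw [linearForm_stdBasis, adDer, mkDerivation_X]) b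

lemma adDer_X (a : Sl2) (i : Fin 3) : adDer a (X i) = linearForm ⁅a, stdBasis i⁆ :=
  mkDerivation_X _ _ _

lemma adDer_add (a b : Sl2) : adDer (a + b) = adDer a + adDer b :=
  derivation_ext fun i => by
    rw [adDer_X, add_lie, map_add, Derivation.add_apply, adDer_X, adDer_X]

lemma adDer_smul (r : ℂ) (a : Sl2) : adDer (r • a) = r • adDer a :=
  derivation_ext fun i => by
    rw [adDer_X, smul_lie, map_smul, Derivation.smul_apply, adDer_X]

lemma adDer_lie (a b : Sl2) : adDer ⁅a, b⁆ = ⁅adDer a, adDer b⁆ :=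
  derivation_ext fun i => by
    rw [adDer_X, Derivation.commutator_apply, adDer_X, adDer_X, adDer_linearForm,
      adDer_linearForm, ← map_sub, lie_lie]

/-- The polynomial ring in `f̄, h̄, ē` as a `𝔗`-module. -/
def PolyModule : Type := MvPolynomial (Fin 3) ℂ

instance : AddCommGroup PolyModule := inferInstanceAs (AddCommGroup (MvPolynomial (Fin 3) ℂ))
instance : Module ℂ PolyModule := inferInstanceAs (Module ℂ (MvPolynomial (Fin 3) ℂ))

/-- A polynomial, as an element of the `𝔗`-module. -/
def polyMk : MvPolynomial (Fin 3) ℂ ≃ₗ[ℂ] PolyModule := LinearEquiv.refl ℂ _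

instance : LieRingModule Takiff PolyModule where
  bracket t p := polyMk (adDer (even t) (polyMk.symm p) + linearForm (odd t) * polyMk.symm p)
  add_lie s t p := by
    simp only [map_add, adDer_add, Derivation.add_apply, add_mul]; abel
  lie_add s p q := by
    simp only [map_add, mul_add]; abel
  leibniz_lie s t p := by
    rw [← map_add]
    congr 1
    simp only [LinearEquiv.symm_apply_apply, even_lie, odd_lie, adDer_lie,
      Derivation.commutator_apply, map_add, Derivation.leibniz, adDer_linearForm, smul_eq_mul]
    rw [← lie_skew (odd s) (even t), map_neg]
    ring

lemma lie_polyMk (t : Takiff) (p : MvPolynomial (Fin 3) ℂ) :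
    ⁅t, polyMk p⁆ = polyMk (adDer (even t) p + linearForm (odd t) * p) := rfl

instance : LieModule ℂ Takiff PolyModule where
  smul_lie r t p := by
    obtain ⟨p, rfl⟩ := polyMk.surjective p
    rw [lie_polyMk, lie_polyMk, map_smul, map_smul, adDer_smul, map_smul, Derivation.smul_apply,
      smul_mul_assoc, ← smul_add, map_smul]
  lie_smul r t p := by
    obtain ⟨p, rfl⟩ := polyMk.surjective p
    rw [← map_smul, lie_polyMk, lie_polyMk, Derivation.map_smul, mul_smul_comm, ← smul_add, map_smul]

instance : Module U PolyModule := uModule _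
instance : IsScalarTower ℂ U PolyModule := uModule_isScalarTower _

lemma even_bar (a : Sl2) : even (bar a) = 0 := by
  change even (tens _ a) = 0
  rw [even_tens]; simp

lemma odd_bar (a : Sl2) : odd (bar a) = a := by
  change odd (tens _ a) = a
  rw [odd_tens]; simp

lemma even_incl (a : Sl2) : even (incl a) = a := by
  change even (tens _ a) = a
  rw [even_tens]; simp

lemma odd_incl (a : Sl2) : odd (incl a) = 0 := by
  change odd (tens _ a) = 0
  rw [odd_tens]; simp

lemma uBar_smul_polyMk (a : Sl2) (p : MvPolynomial (Fin 3) ℂ) :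
    uBar a • polyMk p = polyMk (linearForm a * p) := by
  rw [uBar, uModule_iota_smul, lie_polyMk, even_bar, odd_bar]
  have : adDer 0 = 0 := by simpa using adDer_smul 0 0
  rw [this, Derivation.zero_apply, zero_add]

instance : CommRing UBar :=
  { (inferInstance : Ring UBar) with
    mul_comm := fun a b => Subtype.ext (UBar_mul_comm a.2 b.2) }

/-- The algebra map from the polynomial ring to `U(𝔤̄)`. -/
def polyHom : MvPolynomial (Fin 3) ℂ →ₐ[ℂ] UBar :=
  aeval fun i => ⟨uBar (stdBasis i), uBar_mem _⟩

lemma polyHom_X (i : Fin 3) : polyHom (X i) = ⟨uBar (stdBasis i), uBar_mem _⟩ := aeval_X _ _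

lemma polyHom_smul (p q : MvPolynomial (Fin 3) ℂ) :
    (polyHom p : U) • polyMk q = polyMk (p * q) := by
  induction p using MvPolynomial.induction_on generalizing q with
  | C r =>
    have : ((polyHom (C r) : UBar) : U) = algebraMap ℂ U r := by
      rw [polyHom, aeval_C]; rfl
    rw [this, algebraMap_smul, ← map_smul, MvPolynomial.smul_eq_C_mul]
  | add p p' hp hp' =>
    rw [map_add, AddMemClass.coe_add, add_smul, hp, hp', ← map_add, add_mul]
  | mul_X p i hp =>
    rw [map_mul, MulMemClass.coe_mul, mul_smul, polyHom_X, uBar_smul_polyMk, linearForm_stdBasis,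
      hp, mul_assoc]

/-- The polynomial p, acting on 1 in the polynomial module, returns p. This takes the place of the
Poincaré–Birkhoff–Witt theorem. -/
lemma polyHom_injective : Function.Injective polyHom := fun p q hpq => by
  have h1 := polyHom_smul p 1
  rw [hpq, polyHom_smul, mul_one, mul_one] at h1
  exact (polyMk.injective h1).symm

lemma polyHom_surjective : Function.Surjective polyHom := by
  have hle : UBar ≤ (polyHom.range).map UBar.val := by
    refine Algebra.adjoin_le ?_
    rintro _ ⟨a, rfl⟩
    obtain ⟨x, y, z, rfl⟩ := sl2_decomp a
    refine ⟨polyHom (x • X 0 + y • X 1 + z • X 2), ⟨_, rfl⟩, ?_⟩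
    change UBar.val (polyHom _) = _
    simp only [map_add, map_smul, polyHom_X, uBar_add, uBar_smul]
    rfl
  intro u
  obtain ⟨_, ⟨p, rfl⟩, hp⟩ := hle u.2
  exact ⟨p, Subtype.ext hp⟩

/-- `C̄ - χ` as an element of `U(𝔤̄)`. -/
def casBar (χ : ℂ) : UBar := ⟨Cbar, Cbar_mem⟩ - algebraMap ℂ UBar χ

lemma coe_casBar (χ : ℂ) : (casBar χ : U) = Cbar - algebraMap ℂ U χ := rfl

lemma casBar_eq (χ : ℂ) : casBar χ = polyHom (X 1 ^ 2 + 4 * (X 0 * X 2) - C χ) := by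
  have h4 : polyHom 4 = 4 := map_ofNat _ 4
  rw [map_sub, map_add, map_mul, map_mul, map_pow, polyHom_X, polyHom_X, polyHom_X, h4]
  have h1 : polyHom (C χ) = algebraMap ℂ UBar χ := by rw [polyHom, aeval_C]
  rw [h1]; rfl

lemma casBar_mul_cancel {χ : ℂ} {u v : UBar} (huv : casBar χ * u = casBar χ * v) : u = v := by
  obtain ⟨p, rfl⟩ := polyHom_surjective u
  obtain ⟨q, rfl⟩ := polyHom_surjective v
  rw [casBar_eq, ← map_mul, ← map_mul] at huv
  refine congrArg polyHom (mul_left_cancel₀ (fun h0 => ?_) (polyHom_injective huv))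
  -- At this point C̄ - χ takes the value 1.
  have := congrArg (eval ![(χ + 1) / 4, 0, 1]) h0
  simp [mul_div_cancel₀] at this

lemma casBar_mul_ne_one {χ : ℂ} (u : UBar) : casBar χ * u ≠ 1 := by
  obtain ⟨p, rfl⟩ := polyHom_surjective u
  rw [casBar_eq, ← map_mul, ← map_one polyHom]
  intro h0
  -- A zero of C̄ - χ, which therefore is not a unit.
  have := congrArg (eval ![χ / 4, 0, 1]) (polyHom_injective h0)
  simp [mul_div_cancel₀] at this

end Polynomial

/-! ### Homomorphisms over 𝔗 and over U(𝔗) -/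

section Compatible

variable {M N : Type*} [AddCommGroup M] [Module ℂ M] [Module U M] [IsScalarTower ℂ U M]
  [LieRingModule Takiff M] [LieModule ℂ Takiff M]
  [AddCommGroup N] [Module ℂ N] [Module U N] [IsScalarTower ℂ U N]
  [LieRingModule Takiff N] [LieModule ℂ Takiff N]

variable (M) in
/-- The actions of `𝔗` and of `U(𝔗)` on `M` are compatible. -/
def IsCompatible : Prop :=
  ∀ (t : Takiff) (x : M), (UniversalEnvelopingAlgebra.ι ℂ t : U) • x = ⁅t, x⁆

/-- A homomorphism of `𝔗`-modules as a homomorphism of `U(𝔗)`-modules. -/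
def toLinear (hM : IsCompatible M) (hN : IsCompatible N) (φ : M →ₗ⁅ℂ, Takiff⁆ N) : M →ₗ[U] N where
  toFun := φ
  map_add' := map_add φ
  map_smul' u x := by
    change φ (u • x) = u • φ x
    induction u using U_induction generalizing x with
    | algebraMap r => rw [algebraMap_smul, algebraMap_smul, map_smul]
    | iota t => rw [hM, hN, LieModuleHom.map_lie]
    | mul a b ha hb => rw [mul_smul, mul_smul, ha, hb]
    | add a b ha hb => rw [add_smul, add_smul, map_add, ha, hb]

/-- A homomorphism of `U(𝔗)`-modules as a homomorphism of `𝔗`-modules. -/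
def toLieHom (hM : IsCompatible M) (hN : IsCompatible N) (φ : M →ₗ[U] N) : M →ₗ⁅ℂ, Takiff⁆ N where
  toLinearMap := φ.restrictScalars ℂ
  map_lie' {t x} := by
    change φ ⁅t, x⁆ = ⁅t, φ x⁆
    rw [← hM, ← hN, map_smul]

end Compatible

lemma Cbar_comm_all (u : U) : u * Cbar = Cbar * u := by
  induction u using U_induction with
  | algebraMap r => exact Algebra.commutes r Cbar
  | iota t =>
    rw [takiff_decomp t, map_add, add_mul, mul_add]
    exact congrArg₂ (· + ·) (Cbar_comm _) (UBar_mul_comm (uBar_mem _) Cbar_mem)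
  | mul a b ha hb => rw [mul_assoc, hb, ← mul_assoc, ha, mul_assoc]
  | add a b ha hb => rw [add_mul, mul_add, ha, hb]

lemma casBar_comm (χ : ℂ) (u : U) : u * (casBar χ : U) = casBar χ * u := by
  rw [coe_casBar, mul_sub, sub_mul, Cbar_comm_all, Algebra.commutes]

lemma mem_powIdeal {χ : ℂ} {k : ℕ} {u : UBar} :
    u ∈ powIdeal χ k ↔ ∃ v, casBar χ ^ k * v = u := Iff.rfl

/-! ### U(𝔤̄) and its quotients as U(𝔗)-modules -/

section UBarModules

instance : Module U UBar := uModule _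
instance : IsScalarTower ℂ U UBar := uModule_isScalarTower _

lemma isCompatible_UBar : IsCompatible UBar := uModule_iota_smul _

lemma uIncl_smul_UBar (a : Sl2) (u : UBar) :
    ((uIncl a • u : UBar) : U) = uIncl a * u - u * uIncl a := by
  rw [uIncl, isCompatible_UBar, coe_lie, even_incl, odd_incl]
  have : uBar 0 = 0 := by simp [uBar]
  rw [this, zero_mul, add_zero]; rfl

lemma coe_smul_UBar (u v : UBar) : (u : U) • v = u * v := by
  obtain ⟨u, hu⟩ := u
  change u • v = _
  induction hu using Algebra.adjoin_induction generalizing v with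
  | mem x hx =>
    obtain ⟨b, rfl⟩ := hx
    have hb : uBar b • v = ⁅bar b, v⁆ := isCompatible_UBar _ _
    rw [hb]
    refine Subtype.ext ?_
    rw [coe_lie, even_bar, odd_bar]
    have : uIncl 0 = 0 := by simp [uIncl]
    rw [this, zero_mul, mul_zero, sub_zero, zero_add]; rfl
  | algebraMap r =>
    rw [algebraMap_smul]
    exact Algebra.smul_def r v
  | add x y hx hy h1 h2 =>
    rw [add_smul, h1, h2, ← add_mul]; rfl
  | mul x y hx hy h1 h2 =>
    rw [mul_smul, h2, h1, ← mul_assoc]; rfl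

variable (χ : ℂ) (k : ℕ)

instance : Module U (UBar ⧸ powIdeal χ k) := uModule _
instance : IsScalarTower ℂ U (UBar ⧸ powIdeal χ k) := uModule_isScalarTower _

lemma isCompatible_quotient : IsCompatible (UBar ⧸ powIdeal χ k) := uModule_iota_smul _

/-- The quotient map `U(𝔤̄) → U(𝔤̄) / (C̄ - χ)ᵏ`. -/
def quotMk : UBar →ₗ[U] UBar ⧸ powIdeal χ k :=
  toLinear isCompatible_UBar (isCompatible_quotient χ k) (LieSubmodule.Quotient.mk' _)

lemma quotMk_surjective : Function.Surjective (quotMk χ k) :=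
  LieSubmodule.Quotient.surjective_mk' _

lemma quotMk_eq_zero {u : UBar} : quotMk χ k u = 0 ↔ ∃ v, casBar χ ^ k * v = u :=
  (LieSubmodule.Quotient.mk_eq_zero' (N := powIdeal χ k)).trans mem_powIdeal

lemma coe_smul_quotMk_one (u : UBar) : (u : U) • quotMk χ k 1 = quotMk χ k u := by
  rw [← map_smul, coe_smul_UBar, mul_one]

lemma uIncl_smul_quotMk_one (a : Sl2) : uIncl a • quotMk χ k 1 = 0 := by
  have : uIncl a • (1 : UBar) = 0 := Subtype.ext (by
    rw [uIncl_smul_UBar, OneMemClass.coe_one, mul_one, one_mul, sub_self]; rfl)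
  rw [← map_smul, this, map_zero]

end UBarModules

/-! ### Maps determined by 𝔤-invariant vectors -/

section Invariants

variable {M : Type*} [AddCommGroup M] [Module ℂ M] [Module U M] [IsScalarTower ℂ U M]

/-- For a `𝔤`-invariant vector `m`, the map `u ↦ u m` on `U(𝔤̄)`. -/
def orbitMap (m : M) (hm : ∀ a, uIncl a • m = 0) : UBar →ₗ[U] M where
  toFun u := (u : U) • m
  map_add' u v := add_smul (u : U) (v : U) m
  map_smul' x u := by
    change ((x • u : UBar) : U) • m = x • (u : U) • m
    -- The correction term of the adjoint action, u a m, vanishes by invariance.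
    have hincl (a : Sl2) (u : UBar) : ((uIncl a • u : UBar) : U) • m = uIncl a • (u : U) • m := by
      rw [uIncl_smul_UBar, sub_smul, mul_smul, mul_smul, hm, smul_zero, sub_zero]
    have hbar (a : Sl2) (u : UBar) : ((uBar a • u : UBar) : U) • m = uBar a • (u : U) • m := by
      rw [show uBar a • u = (⟨uBar a, uBar_mem a⟩ : UBar) * u from
        coe_smul_UBar ⟨uBar a, uBar_mem a⟩ u, MulMemClass.coe_mul, mul_smul]
    induction x using U_induction generalizing u with
    | algebraMap r => rw [algebraMap_smul, algebraMap_smul, ← smul_assoc]; rfl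
    | iota t =>
      rw [takiff_decomp t, map_add, add_smul, add_smul, AddMemClass.coe_add, add_smul]
      exact congrArg₂ (· + ·) (hincl _ _) (hbar _ _)
    | mul a b ha hb => rw [mul_smul, mul_smul, ha, hb]
    | add a b ha hb => rw [add_smul, add_smul, AddMemClass.coe_add, add_smul, ha, hb]

lemma orbitMap_apply (m : M) (hm : ∀ a, uIncl a • m = 0) (u : UBar) :
    orbitMap m hm u = (u : U) • m := rfl

/-- Every element of `U(𝔗) m` is of the form `u m` with `u ∈ U(𝔤̄)`, if `m` is invariant. -/
lemma exists_uBar_smul_eq {m : M} (hm : ∀ a, uIncl a • m = 0) (u : U) :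
    ∃ v : UBar, (v : U) • m = u • m := by
  refine ⟨u • (1 : UBar), ?_⟩
  have h1 : (orbitMap m hm) (u • (1 : UBar)) = u • (orbitMap m hm) 1 := map_smul _ _ _
  rw [orbitMap_apply, orbitMap_apply, OneMemClass.coe_one, one_smul] at h1
  exact h1

omit [Module ℂ M] [IsScalarTower ℂ U M] in
lemma casBar_smul_eq_zero {χ : ℂ} {m : M} (h0 : (casBar χ : U) • m = 0) (u : U) :
    (casBar χ : U) • u • m = 0 := by
  rw [← mul_smul, ← casBar_comm, mul_smul, h0, smul_zero]

/-- The map `U(𝔤̄) / (C̄ - χ)ᵏ → M` attached to a `𝔤`-invariant vector killed by `(C̄ - χ)ᵏ`. -/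
def quotLift (χ : ℂ) (k : ℕ) [LieRingModule Takiff M] [LieModule ℂ Takiff M] (hM : IsCompatible M)
    (m : M) (hm : ∀ a, uIncl a • m = 0) (h0 : ((casBar χ ^ k : UBar) : U) • m = 0) :
    (UBar ⧸ powIdeal χ k) →ₗ⁅ℂ, Takiff⁆ M where
  toLinearMap := (powIdeal χ k).toSubmodule.liftQ ((orbitMap m hm).restrictScalars ℂ) (by
    intro u hu
    obtain ⟨v, rfl⟩ := mem_powIdeal.mp hu
    change ((casBar χ ^ k * v : UBar) : U) • m = 0
    rw [mul_comm, MulMemClass.coe_mul, mul_smul, h0, smul_zero])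
  map_lie' {t x} := by
    obtain ⟨u, rfl⟩ := LieSubmodule.Quotient.surjective_mk' (powIdeal χ k) x
    rw [← LieModuleHom.map_lie]
    change orbitMap m hm ⁅t, u⁆ = ⁅t, orbitMap m hm u⁆
    rw [← isCompatible_UBar, map_smul, hM]

variable {χ : ℂ}

/-- The map `Q(0, χ) → M` attached to a `𝔤`-invariant vector killed by `C̄ - χ`. -/
def qLift (m : M) (hm : ∀ a, uIncl a • m = 0) (h0 : (casBar χ : U) • m = 0) :
    Qchi χ →ₗ[U] M :=
  (Q0Sub χ).liftQ ((Submodule.span U (Set.range uIncl)).liftQ (LinearMap.toSpanSingleton U M m)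
    (Submodule.span_le.mpr (by rintro _ ⟨a, rfl⟩; exact hm a)))
    (Submodule.span_le.mpr (by
      rintro _ ⟨w, rfl⟩
      obtain ⟨u, rfl⟩ := Submodule.mkQ_surjective _ w
      change ((Cbar - algebraMap ℂ U χ) * u) • m = 0
      rw [mul_smul, ← coe_casBar, casBar_smul_eq_zero h0]))

variable (χ) in
/-- The canonical generator of `Q(0, χ)`. -/
def qOne : Qchi χ := (Q0Sub χ).mkQ ((Submodule.span U (Set.range uIncl)).mkQ 1)

omit [Module ℂ M] [IsScalarTower ℂ U M] in
lemma qLift_qOne (m : M) (hm : ∀ a, uIncl a • m = 0) (h0 : (casBar χ : U) • m = 0) :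
    qLift m hm h0 (qOne χ) = m := one_smul U m

end Invariants

/-! ### Q(0, χ) and its self-extensions -/

section Q

variable (χ : ℂ)

instance : IsScalarTower ℂ U (Qchi χ) :=
  ⟨fun r u w => by rw [smul_Qchi, Algebra.smul_def, mul_smul]⟩

lemma isCompatible_Qchi : IsCompatible (Qchi χ) := fun _ _ => rfl

lemma exists_smul_qOne (w : Qchi χ) : ∃ u : U, u • qOne χ = w := by
  obtain ⟨w, rfl⟩ := Submodule.mkQ_surjective _ w
  obtain ⟨u, rfl⟩ := Submodule.mkQ_surjective _ w
  refine ⟨u, ?_⟩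
  have h1 : u • (1 : U) = u := mul_one u
  have h2 : u • qOne χ =
      (Q0Sub χ).mkQ (u • (Submodule.span U (Set.range uIncl)).mkQ 1) := rfl
  rw [h2, ← map_smul, h1]

lemma uIncl_smul_qOne (a : Sl2) : uIncl a • qOne χ = 0 := by
  have h2 : uIncl a • qOne χ =
      (Q0Sub χ).mkQ (uIncl a • (Submodule.span U (Set.range uIncl)).mkQ 1) := rfl
  have h3 : (Submodule.span U (Set.range uIncl)).mkQ (uIncl a • 1) = 0 :=
    (Submodule.Quotient.mk_eq_zero _).mpr
      (Submodule.smul_mem_iff_of_isUnit _ isUnit_one |>.mp (by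
        rw [one_smul, smul_eq_mul, mul_one]; exact Submodule.subset_span ⟨a, rfl⟩))
  rw [h2, ← map_smul, h3, map_zero]
  rfl

lemma casBar_smul_Qchi (w : Qchi χ) : (casBar χ : U) • w = 0 := by
  obtain ⟨w, rfl⟩ := Submodule.mkQ_surjective _ w
  exact (Submodule.Quotient.mk_eq_zero _).mpr (Submodule.subset_span ⟨w, rfl⟩)

lemma exists_uBar_smul_qOne (w : Qchi χ) : ∃ u : UBar, (u : U) • qOne χ = w := by
  obtain ⟨u, rfl⟩ := exists_smul_qOne χ w
  exact exists_uBar_smul_eq (uIncl_smul_qOne χ) u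

/-- For an invariant vector both `cMix` and `lower 0` vanish automatically, so the theory of
generators applies to Q(0, χ) with n = c = 0, with no appeal to simplicity. -/
lemma isGenerator_qOne : IsGenerator (qOne χ) 0 0 χ := by
  have hh : IsHighest (qOne χ) (0 : ℕ) := ⟨uIncl_smul_qOne χ e, by
    rw [Nat.cast_zero, zero_smul]; exact uIncl_smul_qOne χ h⟩
  have hf : fOp (qOne χ) = 0 := uIncl_smul_qOne χ f
  have hC : cMix (qOne χ) = (0 : ℂ) • qOne χ := by
    rw [zero_smul, cMix_of_invariant (by simpa using hh) hf]
  have hχ : cBar (qOne χ) = χ • qOne χ := by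
    have := casBar_smul_Qchi χ (qOne χ)
    rw [coe_casBar, sub_smul, algebraMap_smul, sub_eq_zero] at this
    exact this
  have hl : lower (0 : ℕ) (qOne χ) = 0 := by
    rw [lower, hBar_of_invariant hf]; simp
  refine ⟨hh, by simpa using hf, hC, hχ, eq_top_iff.mpr fun w _ => ?_⟩
  obtain ⟨u, rfl⟩ := exists_smul_qOne χ w
  exact smul_mem_strings hh hC hχ (fBar_mem_strings hh hC hl fun _ => hf) u (self_mem_strings _)

/-- An element of `U(𝔤̄)` that annihilates the generator of `Q(0, χ)` is divisible by `C̄ - χ`. -/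
lemma smul_qOne_eq_zero {u : UBar} (hu : (u : U) • qOne χ = 0) : ∃ v, casBar χ * v = u := by
  -- The universal property gives a map from Q(0, χ) to U(𝔤̄)/(C̄ - χ) taking generator to
  -- generator, where divisibility can be read off.
  have h0 : (casBar χ : U) • quotMk χ 1 1 = 0 := by
    rw [coe_smul_quotMk_one]; exact (quotMk_eq_zero χ 1).mpr ⟨1, by rw [pow_one, mul_one]⟩
  have h1 := congrArg (qLift (quotMk χ 1 1) (uIncl_smul_quotMk_one χ 1) h0) hu
  rw [map_smul, map_zero, qLift_qOne, coe_smul_quotMk_one] at h1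
  simpa using (quotMk_eq_zero χ 1).mp h1

lemma mul_casBar_smul (u : UBar) {M : Type*} [AddCommGroup M] [Module U M] (m : M) :
    ((casBar χ * u : UBar) : U) • m = (u : U) • (casBar χ : U) • m := by
  rw [mul_comm, MulMemClass.coe_mul, mul_smul]

/-- The inclusion is multiplication by C̄ - χ, the projection is reduction. A section s would make 1
- s(1) and s(1), hence 1, be killed by C̄ - χ modulo (C̄ - χ)²; cancelling would make C̄ - χ a unit.
-/
lemma exists_nonsplit : ∃ (i : Qchi χ →ₗ⁅ℂ, Takiff⁆ UBarModSq χ)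
    (p : UBarModSq χ →ₗ⁅ℂ, Takiff⁆ Qchi χ), IsShortExact i p ∧ ¬ IsSplit p := by
  have hinv (a : Sl2) : uIncl a • quotMk χ 2 (casBar χ) = 0 := by
    rw [← coe_smul_quotMk_one, ← mul_smul, casBar_comm, mul_smul, uIncl_smul_quotMk_one, smul_zero]
  have hz : (casBar χ : U) • quotMk χ 2 (casBar χ) = 0 := by
    rw [← map_smul, coe_smul_UBar]
    exact (quotMk_eq_zero χ 2).mpr ⟨1, by rw [mul_one, pow_two]⟩
  have hz2 : ((casBar χ ^ 2 : UBar) : U) • qOne χ = 0 := by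
    rw [pow_two, MulMemClass.coe_mul, mul_smul, casBar_smul_Qchi]
  let i := qLift (quotMk χ 2 (casBar χ)) hinv hz
  let p := quotLift χ 2 (isCompatible_Qchi χ) (qOne χ) (uIncl_smul_qOne χ) hz2
  have hi (u : UBar) : i ((u : U) • qOne χ) = quotMk χ 2 (casBar χ * u) := by
    rw [map_smul, qLift_qOne, ← map_smul, coe_smul_UBar, mul_comm]
  have hp (u : UBar) : p (quotMk χ 2 u) = (u : U) • qOne χ := rfl
  have hker (x : UBarModSq χ) (hx : p x = 0) : ∃ y, i y = x := by
    obtain ⟨u, rfl⟩ := quotMk_surjective χ 2 x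
    obtain ⟨v, rfl⟩ := smul_qOne_eq_zero χ (u := u) hx
    exact ⟨(v : U) • qOne χ, hi v⟩
  refine ⟨toLieHom (isCompatible_Qchi χ) (isCompatible_quotient χ 2) i, p, ⟨?_, ?_, ?_⟩, ?_⟩
  · refine (injective_iff_map_eq_zero (i : Qchi χ →+ UBarModSq χ)).mpr fun w hw => ?_
    obtain ⟨u, rfl⟩ := exists_uBar_smul_qOne χ w
    obtain ⟨v, hv⟩ := (quotMk_eq_zero χ 2).mp ((hi u).symm.trans hw)
    rw [pow_two, mul_assoc] at hv
    rw [← casBar_mul_cancel hv, mul_casBar_smul, casBar_smul_Qchi, smul_zero]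
  · intro x
    refine ⟨fun hx => hker x hx, ?_⟩
    rintro ⟨w, rfl⟩
    obtain ⟨u, rfl⟩ := exists_uBar_smul_qOne χ w
    change p (i _) = 0
    rw [hi, hp, mul_casBar_smul, casBar_smul_Qchi, smul_zero]
  · intro w
    obtain ⟨u, rfl⟩ := exists_uBar_smul_qOne χ w
    exact ⟨quotMk χ 2 u, hp u⟩
  · rintro ⟨s, hs⟩
    let s' := toLinear (isCompatible_Qchi χ) (isCompatible_quotient χ 2) s
    have h1 : p (quotMk χ 2 1 - s' (qOne χ)) = 0 := by
      rw [map_sub, hp, OneMemClass.coe_one, one_smul]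
      exact sub_eq_zero.mpr (hs _).symm
    obtain ⟨y, hy⟩ := hker _ h1
    have h2 : (casBar χ : U) • (quotMk χ 2 1 - s' (qOne χ)) = 0 := by
      rw [← hy, ← map_smul, casBar_smul_Qchi, map_zero]
    rw [smul_sub, ← map_smul s', casBar_smul_Qchi, map_zero, sub_zero, coe_smul_quotMk_one] at h2
    obtain ⟨v, hv⟩ := (quotMk_eq_zero χ 2).mp h2
    rw [pow_two, mul_assoc] at hv
    exact casBar_mul_ne_one v (casBar_mul_cancel (hv.trans (mul_one _).symm))

theorem equiv_of_nonsplit {M : Type*} [AddCommGroup M] [Module ℂ M] [LieRingModule Takiff M]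
    [LieModule ℂ Takiff M] (i : Qchi χ →ₗ⁅ℂ, Takiff⁆ M) (p : M →ₗ⁅ℂ, Takiff⁆ Qchi χ)
    (hex : IsShortExact i p) (hns : ¬ IsSplit p) : Nonempty (M ≃ₗ⁅ℂ, Takiff⁆ UBarModSq χ) := by
  let _ := uModule M
  have _ := uModule_isScalarTower M
  have hM : IsCompatible M := uModule_iota_smul M
  obtain ⟨hi, hip, hp⟩ := hex
  let i' := toLinear (isCompatible_Qchi χ) hM i
  let p' := toLinear hM (isCompatible_Qchi χ) p
  have hi' : Function.Injective i' := hi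
  have hip' : Function.Exact i' p' := hip
  have hgen := isGenerator_qOne χ
  obtain ⟨m₀, hm₀⟩ := hp (qOne χ)
  have hm₀' : p' m₀ = qOne χ := hm₀
  -- With n = 0 the lift is killed by e, h and f, so it is 𝔤-invariant.
  obtain ⟨x, hx, hfx⟩ := exists_highest_lift hgen.isStringSpanned
    (FNilpotent.extension hip' hgen.fNilpotent hgen.fNilpotent) i' hi' (n := 0) (m := m₀)
    ((hip' _).mp (by rw [map_eOp, hm₀', hgen.highest.e]) |>.imp fun _ h => h.symm)
    ((hip' _).mp (by
      rw [map_sub, map_hOp, map_complex_smul, hm₀', hgen.highest.h, sub_self]) |>.imp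
        fun _ h => h.symm)
  set m := m₀ - i' x with hm
  have hpm : p' m = qOne χ := by rw [hm, map_sub, hip'.apply_apply_eq_zero, sub_zero, hm₀']
  have hinv (a : Sl2) : uIncl a • m = 0 := by
    obtain ⟨r, s, t, rfl⟩ := sl2_decomp a
    have h1 : uIncl e • m = 0 := hx.e
    have h2 : uIncl h • m = 0 := hx.h.trans (by simp)
    have h3 : uIncl f • m = 0 := hfx
    simp only [uIncl_add, uIncl_smul, add_smul, smul_assoc, h1, h2, h3, smul_zero, add_zero]
  obtain ⟨y, hy⟩ := (hip' ((casBar χ : U) • m)).mp (by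
    rw [map_smul, hpm, casBar_smul_Qchi])
  have hinv' (a : Sl2) : uIncl a • (casBar χ : U) • m = 0 := by
    rw [← mul_smul, casBar_comm, mul_smul, hinv, smul_zero]
  have hyh : IsHighest y (0 : ℕ) := by
    refine IsHighest.of_map hi' (hy ▸ ⟨hinv' e, ?_⟩)
    rw [Nat.cast_zero, zero_smul]; exact hinv' h
  -- (C̄ - χ) m is again invariant, and the invariants of Q(0, χ) are the multiples of its
  -- generator.
  obtain ⟨a, rfl⟩ := hgen.eq_smul hyh
  rw [map_complex_smul] at hy
  -- If a = 0, then m satisfies the relations of the generator of Q(0, χ), which gives a section.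
  have ha : a ≠ 0 := by
    rintro rfl
    rw [zero_smul] at hy
    apply hns
    refine ⟨toLieHom (isCompatible_Qchi χ) hM (qLift m hinv hy.symm), fun w => ?_⟩
    obtain ⟨u, rfl⟩ := exists_smul_qOne χ w
    change p' (qLift m hinv hy.symm (u • qOne χ)) = u • qOne χ
    rw [map_smul, qLift_qOne, map_smul, hpm]
  have hz2 : ((casBar χ ^ 2 : UBar) : U) • m = 0 := by
    rw [pow_two, MulMemClass.coe_mul, mul_smul, ← hy, smul_comm, ← map_smul, casBar_smul_Qchi,
      map_zero, smul_zero]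
  let Ψ := quotLift χ 2 hM m hinv hz2
  have hΨ (u : UBar) : Ψ (quotMk χ 2 u) = (u : U) • m := rfl
  have hinj : Function.Injective Ψ := by
    refine (injective_iff_map_eq_zero Ψ).mpr fun z hz => ?_
    obtain ⟨u, rfl⟩ := quotMk_surjective χ 2 z
    rw [hΨ] at hz
    have h1 : (u : U) • qOne χ = 0 := by rw [← hpm, ← map_smul, hz, map_zero]
    obtain ⟨v, rfl⟩ := smul_qOne_eq_zero χ h1
    rw [mul_casBar_smul, ← hy, smul_comm, ← map_smul] at hz
    have h2 : (v : U) • qOne χ = 0 :=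
      hi' (((smul_eq_zero.mp hz).resolve_left ha).trans (map_zero i').symm)
    obtain ⟨w, rfl⟩ := smul_qOne_eq_zero χ h2
    exact (quotMk_eq_zero χ 2).mpr ⟨w, by rw [pow_two, mul_assoc]⟩
  have hsurj : Function.Surjective Ψ := fun z => by
    obtain ⟨u, hu⟩ := exists_uBar_smul_qOne χ (p' z)
    obtain ⟨w, hw⟩ := (hip' (z - (u : U) • m)).mp (by
      rw [map_sub, map_smul, hpm, hu, sub_self])
    obtain ⟨v, rfl⟩ := exists_uBar_smul_qOne χ w
    -- The submodule is reached because a⁻¹ (C̄ - χ) m is the image of the generator.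
    refine ⟨quotMk χ 2 (u + a⁻¹ • (casBar χ * v)), ?_⟩
    rw [hΨ, AddMemClass.coe_add, add_smul]
    have h1 : ((a⁻¹ • (casBar χ * v) : UBar) : U) • m = (v : U) • i' (qOne χ) := by
      change (a⁻¹ • ((casBar χ * v : UBar) : U)) • m = _
      rw [smul_assoc, mul_casBar_smul, ← hy, smul_comm (v : U), inv_smul_smul₀ ha]
    rw [h1, ← map_smul, hw]; abel
  exact ⟨(LieModuleEquiv.mk Ψ (Equiv.ofBijective Ψ ⟨hinj, hsurj⟩).symm
    (Equiv.ofBijective Ψ ⟨hinj, hsurj⟩).symm_apply_apply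
    (Equiv.ofBijective Ψ ⟨hinj, hsurj⟩).apply_symm_apply).symm⟩

end Q

end TakiffSl2

end

open TakiffSl2 in
theorem theorem4p18 :
    (∀ (V : Type*) [AddCommGroup V] [Module ℂ V] [LieRingModule Takiff V] [LieModule ℂ Takiff V],
      IsHarishChandra V → LieModule.IsIrreducible ℂ Takiff V → ¬ FiniteDimensional ℂ V →
        Nonempty (CategoryTheory.Abelian.Ext (toModuleCat V) (toModuleCat V) 1 ≃ₗ[ℂ] ℂ)) ∧
    (∀ χ : ℂ, χ ≠ 0 →
      (∃ (i : Qchi χ →ₗ⁅ℂ, Takiff⁆ UBarModSq χ) (p : UBarModSq χ →ₗ⁅ℂ, Takiff⁆ Qchi χ),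
        IsShortExact i p ∧ ¬ IsSplit p) ∧
      ∀ (M : Type*) [AddCommGroup M] [Module ℂ M] [LieRingModule Takiff M] [LieModule ℂ Takiff M]
        (i : Qchi χ →ₗ⁅ℂ, Takiff⁆ M) (p : M →ₗ⁅ℂ, Takiff⁆ Qchi χ),
        IsShortExact i p → ¬ IsSplit p → Nonempty (M ≃ₗ⁅ℂ, Takiff⁆ UBarModSq χ)) := by
  refine ⟨fun V _ _ _ _ hV hirr hinf => TakiffSl2.ext_self_of_isHarishChandra V hV hirr hinf,
    fun χ _ => ⟨TakiffSl2.exists_nonsplit χ, fun M _ _ _ _ i p hex hns =>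
      TakiffSl2.equiv_of_nonsplit χ i p hex hns⟩⟩
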